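/- Let $0<\omega<\pi$ and let $\Pi_0=(-\infty,0)\times(0,1)\subset\mathbb{R}^2$. Let $A_\pm=(p_\pm,1)$ with $p_\pm<0$, $p_+\neq p_-$, be two distinct points of the upper side of $\Pi_0$. Let $\gamma_\pm:\Pi_0\to\mathbb{C}$ be outgoing solutions of $$\Delta\gamma_\pm+\omega^2\gamma_\pm=0\ \text{ in }\Pi_0,\qquad \partial_\nu\gamma_\pm=\delta_{A_\pm}\ \text{ on }\partial\Pi_0 .$$ This means that: $\gamma_\pm$ is continuous in $\Pi_0$ and integrable on $\{(x,y)\in\Pi_0 : x>-R\}$ for every $R$; one has $$\int_{\Pi_0}\gamma_\pm\,(\Delta\varphi+\omega^2\varphi)\,dx\,dy=-\varphi(A_\pm)$$ for every $\varphi\in C_c^\infty(\mathbb{R}^2)$ with $\partial_\nu\varphi=0$ on $\partial\Pi_0$; and there is $s\in\mathbb{C}$ such that $\gamma_\pm-s\,e^{-i\omega x}$ is exponentially decaying, that is, bounded by $Ce^{\alpha x}$ for some $\alpha>0$, $C$ and all $(x,y)\in\Pi_0$ with $-x$ large enough. Then the following holds. 1. $\gamma_+$ has a limit at $A_-$ and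 $\gamma_-$ has a limit at $A_+$ (from within $\Pi_0$), these limits are equal, and their common value $\tilde\Gamma=\gamma_+(A_-)=\gamma_-(A_+)$ satisfies $\Im(\omega\tilde\Gamma)=\cos(\omega p_+)\cos(\omega p_-)$. 2. With $r_\pm=((x-p_\pm)^2+(y-1)^2)^{1/2}$, there are constants $\Gamma_\pm\in\mathbb{C}$ such that $$\gamma_\pm(x,y)=\frac1\pi\ln\frac1{r_\pm}+\Gamma_\pm+O(r_\pm)\quad\text{as } r_\pm\to0^+ \text{ in }\Pi_0,$$ and they satisfy $\Im(\omega\Gamma_\pm)=\cos^2(\omega p_\pm)$. 3. The number $s$ for which $\gamma_\pm-s\,e^{-i\omega x}$ is exponentially decaying is unique and equals $s_\pm=i\cos(\omega p_\pm)/\omega$, and the function $\gamma_\pm-s_\pm e^{-i\omega x}$ is real-valued in $\Pi_0$. -/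

import Mathlib

open Filter Topology MeasureTheory

namespace HalfStrip

/-- The half-strip `(-∞, 0) × (0, 1)`. -/
def strip : Set (ℝ × ℝ) := Set.Iio 0 ×ˢ Set.Ioo 0 1

/-- The distance `((x - p)² + (y - 1)²)^(1/2)` from `z = (x, y)` to the boundary point `(p, 1)`. -/
noncomputable def dist₁ (p : ℝ) (z : ℝ × ℝ) : ℝ := √((z.1 - p) ^ 2 + (z.2 - 1) ^ 2)

/-- The Laplacian `∂ₓ²φ + ∂ᵧ²φ` of a function of two real variables. -/
noncomputable def laplacian (φ : ℝ × ℝ → ℝ) (z : ℝ × ℝ) : ℝ :=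
  iteratedDeriv 2 (fun x => φ (x, z.2)) z.1 + iteratedDeriv 2 (fun y => φ (z.1, y)) z.2

/-- Test functions: smooth and compactly supported on the closed half-strip (as restrictions of
such functions on the plane), with vanishing normal derivative on its boundary. -/
structure IsNeumannTest (φ : ℝ × ℝ → ℝ) : Prop where
  smooth : ContDiff ℝ ((⊤ : ℕ∞) : WithTop ℕ∞) φ
  compact : HasCompactSupport φ
  bottom : ∀ x ≤ 0, deriv (fun y => φ (x, y)) 0 = 0
  top : ∀ x ≤ 0, deriv (fun y => φ (x, y)) 1 = 0
  side : ∀ y ∈ Set.Icc (0 : ℝ) 1, deriv (fun x => φ (x, y)) 0 = 0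

/-- `γ` is a solution of `Δγ + ω²γ = 0` in the half-strip, `∂_ν γ = δ_A` on its boundary, where
`A = (p, 1)`. The problem is understood in the distributional sense (Green's formula against the
test functions above); `γ` is locally integrable up to the boundary, and is the representative of
its class that is continuous in the half-strip. Values outside the half-strip play no role. -/
structure IsPointSourceSolution (ω p : ℝ) (γ : ℝ × ℝ → ℂ) : Prop where
  continuousOn : ContinuousOn γ strip
  integrableOn : ∀ R : ℝ, IntegrableOn γ (strip ∩ {z | -R < z.1})
  weak : ∀ φ : ℝ × ℝ → ℝ, IsNeumannTest φ →
    ∫ z in strip, γ z * ((laplacian φ z + ω ^ 2 * φ z : ℝ) : ℂ) = -(φ (p, 1) : ℂ)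

/-- The outgoing plane mode `e^{-iωx}`. -/
noncomputable def outgoingMode (ω : ℝ) (z : ℝ × ℝ) : ℂ :=
  Complex.exp (-(Complex.I * ω * z.1))

/-- `f` decays exponentially as `x → -∞` in the half-strip, uniformly in `y`. -/
def ExpDecay (f : ℝ × ℝ → ℂ) : Prop :=
  ∃ α > 0, ∃ C x₀ : ℝ, ∀ z ∈ strip, z.1 ≤ x₀ → ‖f z‖ ≤ C * Real.exp (α * z.1)

/-- `γ` is outgoing with amplitude `s`: `γ = s e^{-iωx} +` an exponentially decaying remainder. -/
def HasAmplitude (ω : ℝ) (γ : ℝ × ℝ → ℂ) (s : ℂ) : Prop :=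
  ExpDecay fun z => γ z - s * outgoingMode ω z

/-- `γ` is an outgoing solution of the Neumann problem with Dirac source at `(p, 1)`. -/
structure IsOutgoingSolution (ω p : ℝ) (γ : ℝ × ℝ → ℂ) : Prop
    extends IsPointSourceSolution ω p γ where
  outgoing : ∃ s : ℂ, HasAmplitude ω γ s

/-- `Γ` is the constant term of `γ` at its singularity `(p, 1)`:
`γ = (1/π) ln (1/r) + Γ + O(r)` as `r → 0⁺`, `r` the distance to `(p, 1)`. -/
def HasLogConstant (p : ℝ) (γ : ℝ × ℝ → ℂ) (Γ : ℂ) : Prop :=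
  Asymptotics.IsBigO (𝓝[strip] (p, 1))
    (fun z => γ z - (((1 / Real.pi * Real.log (1 / dist₁ p z) : ℝ) : ℂ) + Γ)) (dist₁ p)

/-- `Γ` is the constant behaviour of `γ` at the boundary point `(q, 1)`, i.e. the value there of
the continuous extension of `γ`. -/
def HasBoundaryValue (q : ℝ) (γ : ℝ × ℝ → ℂ) (Γ : ℂ) : Prop :=
  Tendsto γ (𝓝[strip] (q, 1)) (𝓝 Γ)

end HalfStrip

/-!
Expand `γ` in the Neumann modes `cos (n π (1 - y))` of the cross-section. The `n`-th coefficient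
solves `c'' - k² c = -δ_p` on the half-line with the Neumann condition at `0`, where
`k² = (n π)² - ω²`, and its behaviour at `-∞` excludes the solution that the outgoing condition
forbids; so it is the exponential Green function of the line plus its reflection at `x = 0`.

Summing the modes back gives `γ` explicitly. In the distance `t = |x ∓ p|` to a pole, the modes
`n ≥ 1` differ from their values at `ω = 0` by a Lipschitz function, and at `ω = 0` they sum to
`-(1/π) log |1 - exp (π (-t + i (1 - y)))|`, the only singular contribution. All of these are real,
so the propagating mode `n = 0` alone accounts for the imaginary parts, as it does for the
amplitude. Reciprocity is the symmetry of the formula in source and receiver.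
-/

namespace HalfStrip

open Set

section CrossModes

open scoped ContDiff

variable {E : Type*} [NormedAddCommGroup E] [NormedSpace ℝ E]

/-- The Neumann modes of the cross-section `(0, 1)`, normalized to be `1` at `y = 1`. -/
noncomputable def crossMode (n : ℕ) (y : ℝ) : ℝ := Real.cos (n * Real.pi * (1 - y))

lemma contDiff_crossMode (n : ℕ) : ContDiff ℝ ∞ (crossMode n) := by
  unfold crossMode
  fun_prop

lemma continuous_crossMode (n : ℕ) : Continuous (crossMode n) :=
  (contDiff_crossMode n).continuous

lemma crossMode_zero (y : ℝ) : crossMode 0 y = 1 := by simp [crossMode]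

lemma crossMode_one (n : ℕ) : crossMode n 1 = 1 := by simp [crossMode]

lemma abs_crossMode_le_one (n : ℕ) (y : ℝ) : |crossMode n y| ≤ 1 := Real.abs_cos_le_one _

lemma crossMode_mem_Icc (n : ℕ) (y : ℝ) : crossMode n y ∈ Icc (-1) 1 := Real.cos_mem_Icc _

lemma eval_chebyshev_crossMode_one (n : ℕ) (y : ℝ) :
    (Polynomial.Chebyshev.T ℝ n).eval (crossMode 1 y) = crossMode n y := by
  rw [crossMode, Polynomial.Chebyshev.T_real_cos, crossMode]
  push_cast
  ring_nf

lemma arccos_crossMode_one {y : ℝ} (hy : y ∈ Icc (0 : ℝ) 1) :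
    Real.arccos (crossMode 1 y) = Real.pi * (1 - y) := by
  rw [crossMode, Nat.cast_one, one_mul]
  exact Real.arccos_cos (mul_nonneg Real.pi_pos.le (sub_nonneg.mpr hy.2))
    (mul_le_of_le_one_right Real.pi_pos.le (by linarith [hy.1]))

lemma integrableOn_Ioo_continuous_smul {g : ℝ → E} {a b : ℝ} (hg : IntegrableOn g (Ioo a b))
    {f : ℝ → ℝ} (hf : Continuous f) : IntegrableOn (fun y => f y • g y) (Ioo a b) := by
  rw [← integrableOn_Icc_iff_integrableOn_Ioo] at hg ⊢
  exact hg.continuousOn_smul hf.continuousOn isCompact_Icc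

lemma integral_polynomial_crossMode_smul_eq_zero {g : ℝ → E} (hg : IntegrableOn g (Ioo 0 1))
    (h : ∀ n, ∫ y in Ioo (0 : ℝ) 1, crossMode n y • g y = 0) (P : Polynomial ℝ) :
    ∫ y in Ioo (0 : ℝ) 1, P.eval (crossMode 1 y) • g y = 0 := by
  have hint (Q : Polynomial ℝ) :
      IntegrableOn (fun y => Q.eval (crossMode 1 y) • g y) (Ioo 0 1) :=
    integrableOn_Ioo_continuous_smul hg (Q.continuous.comp (continuous_crossMode 1))
  have hspan : P ∈ Submodule.span ℝ (range (Polynomial.Chebyshev.chebyshevTsequence ℝ)) := by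
    rw [Polynomial.Sequence.span _ fun n => by simp [Polynomial.Sequence.ne_zero]]
    exact Submodule.mem_top
  induction hspan using Submodule.span_induction with
  | mem _ hQ =>
    obtain ⟨n, rfl⟩ := hQ
    exact (integral_congr_ae (.of_forall fun y =>
      congrArg (· • g y) (eval_chebyshev_crossMode_one n y))).trans (h n)
  | zero => simp
  | add P Q _ _ hP hQ =>
    simp only [Polynomial.eval_add, add_smul]
    rw [integral_add (hint P) (hint Q), hP, hQ, add_zero]
  | smul a P _ hP =>
    simp only [Polynomial.eval_smul, smul_assoc, integral_smul, hP, smul_zero]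

lemma integral_continuous_smul_eq_zero {g : ℝ → E} (hg : IntegrableOn g (Ioo 0 1))
    (h : ∀ n, ∫ y in Ioo (0 : ℝ) 1, crossMode n y • g y = 0) {f : ℝ → ℝ} (hf : Continuous f) :
    ∫ y in Ioo (0 : ℝ) 1, f y • g y = 0 := by
  set N := ∫ y in Ioo (0 : ℝ) 1, ‖g y‖
  have hbound : ∀ ε > 0, ‖∫ y in Ioo (0 : ℝ) 1, f y • g y‖ ≤ ε * N := by
    intro ε hε
    obtain ⟨P, hP⟩ := exists_polynomial_near_of_continuousOn (-1) 1
      (fun v => f (1 - Real.arccos v / Real.pi)) (by fun_prop) ε hε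
    have hPf : ∀ y ∈ Ioo (0 : ℝ) 1, |f y - P.eval (crossMode 1 y)| ≤ ε := by
      intro y hy
      have := hP (crossMode 1 y) (crossMode_mem_Icc 1 y)
      rw [arccos_crossMode_one (Ioo_subset_Icc_self hy),
        mul_div_cancel_left₀ _ Real.pi_ne_zero, sub_sub_cancel, abs_sub_comm] at this
      exact this.le
    have hsub := integral_sub (integrableOn_Ioo_continuous_smul hg hf)
      (integrableOn_Ioo_continuous_smul hg (P.continuous.comp (continuous_crossMode 1)))
    simp only [Function.comp_apply] at hsub
    rw [integral_polynomial_crossMode_smul_eq_zero hg h, sub_zero] at hsub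
    rw [← hsub, ← integral_const_mul]
    refine norm_integral_le_of_norm_le (hg.norm.const_mul ε) ?_
    filter_upwards [ae_restrict_mem measurableSet_Ioo] with y hy
    rw [← sub_smul, norm_smul]
    exact mul_le_mul_of_nonneg_right (hPf y hy) (norm_nonneg _)
  have hlim : Tendsto (fun ε => ε * N) (𝓝[>] 0) (𝓝 (0 * N)) :=
    (tendsto_id.mul_const N).mono_left nhdsWithin_le_nhds
  rw [zero_mul] at hlim
  exact norm_le_zero_iff.mp (ge_of_tendsto hlim (eventually_mem_nhdsWithin.mono hbound))

theorem ae_eq_zero_of_integral_crossMode_smul_eq_zero [CompleteSpace E] {g : ℝ → E}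
    (hg : IntegrableOn g (Ioo 0 1))
    (h : ∀ n, ∫ y in Ioo (0 : ℝ) 1, crossMode n y • g y = 0) :
    ∀ᵐ y ∂volume.restrict (Ioo (0 : ℝ) 1), g y = 0 :=
  ae_eq_zero_of_integral_contDiff_smul_eq_zero hg.locallyIntegrable fun _ hf _ =>
    integral_continuous_smul_eq_zero hg h hf.continuous

lemma integral_cos_intCast_mul_pi {m : ℤ} (hm : m ≠ 0) :
    ∫ y in (0 : ℝ)..1, Real.cos (m * Real.pi * (1 - y)) = 0 := by
  have hm' : (m : ℝ) * Real.pi ≠ 0 := mul_ne_zero (mod_cast hm) Real.pi_ne_zero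
  rw [intervalIntegral.integral_comp_sub_left (fun y => Real.cos (m * Real.pi * y)) 1,
    intervalIntegral.integral_comp_mul_left _ hm', integral_cos]
  simp [Real.sin_int_mul_pi]

lemma integral_crossMode_mul_crossMode (m n : ℕ) :
    ∫ y in Ioo (0 : ℝ) 1, crossMode m y * crossMode n y
      = if m = n then (if n = 0 then 1 else 1 / 2) else 0 := by
  have hsplit (y : ℝ) : crossMode m y * crossMode n y
      = 1 / 2 * Real.cos ((m - n : ℤ) * Real.pi * (1 - y))
        + 1 / 2 * Real.cos ((m + n : ℤ) * Real.pi * (1 - y)) := by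
    simp only [crossMode]
    push_cast
    rw [sub_mul, sub_mul, add_mul, add_mul, Real.cos_sub, Real.cos_add]
    ring
  rw [← integral_Ioc_eq_integral_Ioo, ← intervalIntegral.integral_of_le zero_le_one]
  simp_rw [hsplit]
  rw [intervalIntegral.integral_add (Continuous.intervalIntegrable (by fun_prop) _ _)
    (Continuous.intervalIntegrable (by fun_prop) _ _), intervalIntegral.integral_const_mul,
    intervalIntegral.integral_const_mul]
  rcases eq_or_ne m n with rfl | hmn
  · rcases eq_or_ne m 0 with rfl | hm
    · norm_num
    · rw [integral_cos_intCast_mul_pi (m := m + m) (by lia)]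
      simp [hm]
  · rw [integral_cos_intCast_mul_pi (m := m + n) (by lia),
      integral_cos_intCast_mul_pi (m := m - n) (by lia)]
    simp [hmn]

lemma integral_crossMode (n : ℕ) :
    ∫ y in Ioo (0 : ℝ) 1, crossMode n y = if n = 0 then 1 else 0 := by
  simpa [crossMode_zero] using integral_crossMode_mul_crossMode n 0

lemma norm_crossMode_weight_smul_le (a : E) (n : ℕ) (y : ℝ) :
    ‖((if n = 0 then 1 else 2) * crossMode n y) • a‖ ≤ 2 * ‖a‖ := by
  rw [norm_smul, norm_mul]
  refine mul_le_mul_of_nonneg_right ?_ (norm_nonneg a)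
  refine (mul_le_of_le_one_right (norm_nonneg _) (abs_crossMode_le_one n y)).trans ?_
  split_ifs <;> norm_num

lemma continuous_of_hasSum_crossMode_smul [CompleteSpace E] {a : ℕ → E} {f : ℝ → E}
    (ha : Summable fun n => ‖a n‖)
    (hf : ∀ y, HasSum (fun n => ((if n = 0 then 1 else 2) * crossMode n y) • a n) (f y)) :
    Continuous f := by
  rw [show f = _ from funext fun y => (hf y).tsum_eq.symm]
  exact continuous_tsum (fun n => ((continuous_crossMode n).const_mul _).smul continuous_const)
    (ha.mul_left 2) fun n y => norm_crossMode_weight_smul_le (a n) n y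

lemma integral_crossMode_smul_of_hasSum [CompleteSpace E] {a : ℕ → E} {f : ℝ → E}
    (ha : Summable fun n => ‖a n‖)
    (hf : ∀ y, HasSum (fun n => ((if n = 0 then 1 else 2) * crossMode n y) • a n) (f y)) (n : ℕ) :
    ∫ y in Ioo (0 : ℝ) 1, crossMode n y • f y = a n := by
  set F : ℕ → ℝ → E := fun m y => crossMode n y • ((if m = 0 then 1 else 2) * crossMode m y) • a m
  have hF : HasSum (fun m => ∫ y in Ioo (0 : ℝ) 1, F m y)
      (∫ y in Ioo (0 : ℝ) 1, crossMode n y • f y) := by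
    refine hasSum_integral_of_dominated_convergence (fun m _ => 2 * ‖a m‖) (fun m => ?_)
      (fun m => .of_forall fun y => ?_) (.of_forall fun _ => ha.mul_left 2)
      (integrable_const _) (.of_forall fun y => (hf y).const_smul _)
    · exact ((continuous_crossMode n).smul (((continuous_crossMode m).const_mul _).smul
        continuous_const)).aestronglyMeasurable
    · rw [norm_smul]
      exact (mul_le_of_le_one_left (norm_nonneg _) (abs_crossMode_le_one n y)).trans
        (norm_crossMode_weight_smul_le (a m) m y)
  have hFn (m : ℕ) : ∫ y in Ioo (0 : ℝ) 1, F m y = if m = n then a n else 0 := by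
    have hsmul (y : ℝ) : F m y
        = (crossMode n y * crossMode m y) • (if m = 0 then 1 else 2 : ℝ) • a m := by
      simp only [F, smul_smul]
      ring_nf
    simp only [hsmul]
    rw [integral_smul_const, integral_crossMode_mul_crossMode]
    rcases eq_or_ne m n with rfl | hmn
    · split_ifs <;> simp
    · simp [hmn, hmn.symm]
  simp only [hFn] at hF
  exact hF.unique (hasSum_ite_eq n _)

end CrossModes

section HalfLine

open scoped ContDiff

variable {k : ℂ} {p : ℝ} {c : ℝ → ℂ}

/-- The Green function of `k² - d²/dx²` on the line that behaves like `exp (k * x)` at `-∞`, as a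
function of the distance `t` to the pole. -/
noncomputable def lineGreen (k : ℂ) (t : ℝ) : ℂ := Complex.exp (-k * t) / (2 * k)

/-- The Green function with pole `p` of `k² - d²/dx²` on the half-line `(-∞, 0)`, with the Neumann
condition at `0` and behaving like `exp (k * x)` at `-∞`; it is built by reflecting the pole. -/
noncomputable def modeGreen (k : ℂ) (p x : ℝ) : ℂ := lineGreen k |x - p| + lineGreen k |x + p|

/-- Test functions on the closed half-line `(-∞, 0]` with vanishing normal derivative at `0`, given
as restrictions of functions on the whole line. -/
structure IsHalfLineTest {E : Type*} [NormedAddCommGroup E] [NormedSpace ℝ E] (Ψ : ℝ → E) :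
    Prop where
  smooth : ContDiff ℝ ∞ Ψ
  compact : HasCompactSupport Ψ
  deriv_zero : deriv Ψ 0 = 0

/-- `c` solves `c'' - k² c = -δ_p` on the half-line `(-∞, 0)` with the Neumann condition at `0`, in
the distributional sense and up to the boundary. -/
structure IsHalfLineGreen (k : ℂ) (p : ℝ) (c : ℝ → ℂ) : Prop where
  locallyIntegrable : LocallyIntegrable c (volume.restrict (Iio 0))
  weak : ∀ Ψ : ℝ → ℂ, IsHalfLineTest Ψ →
    ∫ x in Iio 0, (deriv (deriv Ψ) x - k ^ 2 * Ψ x) * c x = -Ψ p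

lemma hasDerivAt_exp_mul_ofReal (k : ℂ) (x : ℝ) :
    HasDerivAt (fun t : ℝ => Complex.exp (k * t)) (k * Complex.exp (k * x)) x := by
  simpa [mul_comm] using ((Complex.ofRealCLM.hasDerivAt (x := x)).const_mul k).cexp

lemma hasDerivAt_cosh_mul_ofReal (k : ℂ) (x : ℝ) :
    HasDerivAt (fun t : ℝ => Complex.cosh (k * t)) (k * Complex.sinh (k * x)) x := by
  simpa [mul_comm, Function.comp_def] using (Complex.hasDerivAt_cosh (k * x)).comp x
    ((Complex.ofRealCLM.hasDerivAt (x := x)).const_mul k)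

lemma hasDerivAt_sinh_mul_ofReal (k : ℂ) (x : ℝ) :
    HasDerivAt (fun t : ℝ => Complex.sinh (k * t)) (k * Complex.cosh (k * x)) x := by
  simpa [mul_comm, Function.comp_def] using (Complex.hasDerivAt_sinh (k * x)).comp x
    ((Complex.ofRealCLM.hasDerivAt (x := x)).const_mul k)

lemma contDiff_cosh_mul_ofReal (k : ℂ) : ContDiff ℝ ∞ fun t : ℝ => Complex.cosh (k * t) := by
  have hlin : ContDiff ℝ ∞ fun t : ℝ => k * (t : ℂ) :=
    contDiff_const.mul Complex.ofRealCLM.contDiff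
  exact (hlin.cexp.add hlin.neg.cexp).div_const 2

lemma contDiff_sinh_mul_ofReal (k : ℂ) : ContDiff ℝ ∞ fun t : ℝ => Complex.sinh (k * t) := by
  have hlin : ContDiff ℝ ∞ fun t : ℝ => k * (t : ℂ) :=
    contDiff_const.mul Complex.ofRealCLM.contDiff
  exact (hlin.cexp.sub hlin.neg.cexp).div_const 2

lemma hasDerivAt_integral_of_continuous {h : ℝ → ℂ} (hh : Continuous h) (a x : ℝ) :
    HasDerivAt (fun x => ∫ t in a..x, h t) (h x) x :=
  intervalIntegral.integral_hasDerivAt_right (hh.intervalIntegrable _ _)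
    (hh.stronglyMeasurableAtFilter _ _) hh.continuousAt

lemma contDiff_integral {h : ℝ → ℂ} (hh : ContDiff ℝ ∞ h) (a : ℝ) :
    ContDiff ℝ ∞ fun x => ∫ t in a..x, h t := by
  have hd := hasDerivAt_integral_of_continuous hh.continuous a
  refine contDiff_infty_iff_deriv.mpr ⟨fun x => (hd x).differentiableAt, ?_⟩
  rwa [show deriv (fun x => ∫ t in a..x, h t) = h from funext fun x => (hd x).deriv]

lemma exists_contDiff_hasCompactSupport_eqOn_one (R : ℝ) :
    ∃ χ : ℝ → ℝ, ContDiff ℝ ∞ χ ∧ HasCompactSupport χ ∧ EqOn χ 1 (Ioo (-R) R) := by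
  let b : ContDiffBump (0 : ℝ) := ⟨|R| + 1, |R| + 2, by positivity, by linarith⟩
  refine ⟨b, b.contDiff, b.hasCompactSupport, fun x hx => b.one_of_mem_closedBall ?_⟩
  rw [mem_closedBall_zero_iff, Real.norm_eq_abs]
  exact (abs_lt.mpr hx).le.trans ((le_abs_self R).trans (le_add_of_nonneg_right zero_le_one))

section GreenIdentity

variable {u u' Ψ : ℝ → ℂ}

lemma hasDerivAt_wronskian (hu : ∀ x, HasDerivAt u (u' x) x)
    (hu' : ∀ x, HasDerivAt u' (k ^ 2 * u x) x) (hΨ : ContDiff ℝ ∞ Ψ) (x : ℝ) :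
    HasDerivAt (fun x => u x * deriv Ψ x - u' x * Ψ x)
      (u x * (deriv (deriv Ψ) x - k ^ 2 * Ψ x)) x := by
  obtain ⟨hΨd, hΨ'⟩ := contDiff_infty_iff_deriv.mp hΨ
  have hΨ'd := (contDiff_infty_iff_deriv.mp hΨ').1
  refine (((hu x).mul (hΨ'd x).hasDerivAt).sub ((hu' x).mul (hΨd x).hasDerivAt)).congr_deriv ?_
  ring

lemma continuous_helmholtz (hΨ : ContDiff ℝ ∞ Ψ) (k : ℂ) :
    Continuous fun x => deriv (deriv Ψ) x - k ^ 2 * Ψ x := by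
  have hΨ'' := (contDiff_infty_iff_deriv.mp (contDiff_infty_iff_deriv.mp hΨ).2).2
  exact hΨ''.continuous.sub (hΨ.continuous.const_mul _)

lemma hasCompactSupport_helmholtz (hΨ : HasCompactSupport Ψ) (k : ℂ) :
    HasCompactSupport fun x => deriv (deriv Ψ) x - k ^ 2 * Ψ x :=
  hΨ.deriv.deriv.sub hΨ.mul_left

lemma intervalIntegral_mul_helmholtz (hu : ∀ x, HasDerivAt u (u' x) x)
    (hu' : ∀ x, HasDerivAt u' (k ^ 2 * u x) x) (hΨ : ContDiff ℝ ∞ Ψ) (a b : ℝ) :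
    ∫ x in a..b, u x * (deriv (deriv Ψ) x - k ^ 2 * Ψ x)
      = u b * deriv Ψ b - u' b * Ψ b - (u a * deriv Ψ a - u' a * Ψ a) := by
  have hcont : Continuous u := continuous_iff_continuousAt.mpr fun x => (hu x).continuousAt
  exact intervalIntegral.integral_eq_sub_of_hasDerivAt
    (fun x _ => hasDerivAt_wronskian hu hu' hΨ x)
    ((hcont.mul (continuous_helmholtz hΨ k)).intervalIntegrable _ _)

lemma integral_Iic_mul_helmholtz (hu : ∀ x, HasDerivAt u (u' x) x)
    (hu' : ∀ x, HasDerivAt u' (k ^ 2 * u x) x) (hΨ : ContDiff ℝ ∞ Ψ)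
    (hΨc : HasCompactSupport Ψ) (b : ℝ) :
    ∫ x in Iic b, u x * (deriv (deriv Ψ) x - k ^ 2 * Ψ x) = u b * deriv Ψ b - u' b * Ψ b := by
  have hcont : Continuous u := continuous_iff_continuousAt.mpr fun x => (hu x).continuousAt
  have hderiv : deriv (fun x => u x * deriv Ψ x - u' x * Ψ x)
      = fun x => u x * (deriv (deriv Ψ) x - k ^ 2 * Ψ x) :=
    funext fun x => (hasDerivAt_wronskian hu hu' hΨ x).deriv
  have hsmooth : ContDiff ℝ 1 fun x => u x * deriv Ψ x - u' x * Ψ x :=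
    contDiff_one_iff_deriv.mpr
      ⟨fun x => (hasDerivAt_wronskian hu hu' hΨ x).differentiableAt,
        hderiv ▸ hcont.mul (continuous_helmholtz hΨ k)⟩
  simpa only [hderiv] using HasCompactSupport.integral_Iic_deriv_eq hsmooth
    (hΨc.deriv.mul_left.sub hΨc.mul_left) b

end GreenIdentity

lemma continuous_modeGreen (k : ℂ) (p : ℝ) : Continuous (modeGreen k p) := by
  unfold modeGreen lineGreen
  fun_prop

lemma modeGreen_of_le {x : ℝ} (hp : p ≤ 0) (hx : x ≤ p) :
    modeGreen k p x = Complex.cosh (k * p) / k * Complex.exp (k * x) := by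
  rw [modeGreen, lineGreen, lineGreen, abs_of_nonpos (by linarith), abs_of_nonpos (by linarith),
    Complex.cosh,
    show -k * ((-(x - p) : ℝ) : ℂ) = k * x + -(k * p) by push_cast; ring,
    show -k * ((-(x + p) : ℝ) : ℂ) = k * x + k * p by push_cast; ring,
    Complex.exp_add, Complex.exp_add]
  ring

lemma modeGreen_of_ge {x : ℝ} (hp : p ≤ 0) (hpx : p ≤ x) (hx : x ≤ 0) :
    modeGreen k p x = Complex.exp (k * p) / k * Complex.cosh (k * x) := by
  rw [modeGreen, lineGreen, lineGreen, abs_of_nonneg (by linarith), abs_of_nonpos (by linarith),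
    Complex.cosh,
    show -k * ((x - p : ℝ) : ℂ) = k * p + -(k * x) by push_cast; ring,
    show -k * ((-(x + p) : ℝ) : ℂ) = k * p + k * x by push_cast; ring,
    Complex.exp_add, Complex.exp_add]
  ring

lemma integral_Iic_helmholtz_mul_modeGreen {Ψ : ℝ → ℂ} (hΨ : ContDiff ℝ ∞ Ψ)
    (hΨc : HasCompactSupport Ψ) (hp : p ≤ 0) :
    ∫ x in Iic p, (deriv (deriv Ψ) x - k ^ 2 * Ψ x) * modeGreen k p x
      = Complex.cosh (k * p) / k
        * (Complex.exp (k * p) * deriv Ψ p - k * Complex.exp (k * p) * Ψ p) := by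
  have hexp := hasDerivAt_exp_mul_ofReal k
  have hexp' (x : ℝ) : HasDerivAt (fun t : ℝ => k * Complex.exp (k * t))
      (k ^ 2 * Complex.exp (k * x)) x := ((hexp x).const_mul k).congr_deriv (by ring)
  rw [← integral_Iic_mul_helmholtz hexp hexp' hΨ hΨc, ← integral_const_mul]
  refine setIntegral_congr_fun measurableSet_Iic fun x hx => ?_
  rw [modeGreen_of_le hp hx]
  ring

lemma intervalIntegral_helmholtz_mul_modeGreen {Ψ : ℝ → ℂ} (hΨ : ContDiff ℝ ∞ Ψ)
    (hΨ0 : deriv Ψ 0 = 0) (hp : p ≤ 0) :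
    ∫ x in p..0, (deriv (deriv Ψ) x - k ^ 2 * Ψ x) * modeGreen k p x
      = Complex.exp (k * p) / k
        * (k * Complex.sinh (k * p) * Ψ p - Complex.cosh (k * p) * deriv Ψ p) := by
  have hcosh := hasDerivAt_cosh_mul_ofReal k
  have hcosh' (x : ℝ) : HasDerivAt (fun t : ℝ => k * Complex.sinh (k * t))
      (k ^ 2 * Complex.cosh (k * x)) x :=
    ((hasDerivAt_sinh_mul_ofReal k x).const_mul k).congr_deriv (by ring)
  have h := intervalIntegral_mul_helmholtz hcosh hcosh' hΨ p 0
  simp only [hΨ0, Complex.ofReal_zero, mul_zero, Complex.sinh_zero, zero_mul, sub_zero, zero_sub,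
    neg_sub] at h
  rw [← h, ← intervalIntegral.integral_const_mul]
  refine intervalIntegral.integral_congr fun x hx => ?_
  rw [uIcc_of_le hp] at hx
  rw [modeGreen_of_ge hp hx.1 hx.2]
  ring

theorem isHalfLineGreen_modeGreen (hk : k ≠ 0) (hp : p ≤ 0) :
    IsHalfLineGreen k p (modeGreen k p) where
  locallyIntegrable := (continuous_modeGreen k p).locallyIntegrable
  weak Ψ hΨ := by
    have hint : Integrable fun x => (deriv (deriv Ψ) x - k ^ 2 * Ψ x) * modeGreen k p x :=
      ((continuous_helmholtz hΨ.smooth k).mul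
        (continuous_modeGreen k p)).integrable_of_hasCompactSupport
        (hasCompactSupport_helmholtz hΨ.compact k).mul_right
    have hsplit := intervalIntegral.integral_Iic_sub_Iic (hint.integrableOn (s := Iic p))
      (hint.integrableOn (s := Iic 0))
    rw [← integral_Iic_eq_integral_Iio, sub_eq_iff_eq_add.mp hsplit,
      integral_Iic_helmholtz_mul_modeGreen hΨ.smooth hΨ.compact hp,
      intervalIntegral_helmholtz_mul_modeGreen hΨ.smooth hΨ.deriv_zero hp]
    have hexp : Complex.exp (k * p) * (Complex.cosh (k * p) - Complex.sinh (k * p)) = 1 := by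
      rw [Complex.cosh_sub_sinh, ← Complex.exp_add, add_neg_cancel, Complex.exp_zero]
    field_simp
    linear_combination -k * Ψ p * hexp

section Potential

variable {g : ℝ → ℂ}

lemma exists_neg_forall_le_eq_zero (hg : HasCompactSupport g) : ∃ a < 0, ∀ x ≤ a, g x = 0 := by
  obtain ⟨b, hb⟩ := hg.isCompact.bddBelow
  refine ⟨min b 0 - 1, by linarith [min_le_right b 0], fun x hx => ?_⟩
  by_contra hne
  linarith [hb (subset_tsupport g hne), min_le_left b 0]

lemma exists_potential_eq_zero_of_le (hk : k ≠ 0) (hg : ContDiff ℝ ∞ g) {a : ℝ}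
    (hga : ∀ x ≤ a, g x = 0) :
    ∃ ψ : ℝ → ℂ, ContDiff ℝ ∞ ψ ∧ (∀ x ≤ a, ψ x = 0) ∧
      (∀ x, deriv (deriv ψ) x - k ^ 2 * ψ x = g x) ∧
      deriv ψ 0 = ∫ t in a..(0 : ℝ), g t * Complex.cosh (k * t) := by
  have hcg := hg.mul (contDiff_cosh_mul_ofReal k)
  have hsg := hg.mul (contDiff_sinh_mul_ofReal k)
  set C : ℝ → ℂ := fun x => ∫ t : ℝ in a..x, g t * Complex.cosh (k * t)
  set S : ℝ → ℂ := fun x => ∫ t : ℝ in a..x, g t * Complex.sinh (k * t)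
  have hCd (x : ℝ) : HasDerivAt C (g x * Complex.cosh (k * x)) x :=
    hasDerivAt_integral_of_continuous hcg.continuous a x
  have hSd (x : ℝ) : HasDerivAt S (g x * Complex.sinh (k * x)) x :=
    hasDerivAt_integral_of_continuous hsg.continuous a x
  set ψ : ℝ → ℂ := fun x => k⁻¹ * (Complex.sinh (k * x) * C x - Complex.cosh (k * x) * S x)
  set ψ' : ℝ → ℂ := fun x => Complex.cosh (k * x) * C x - Complex.sinh (k * x) * S x
  have hψ : deriv ψ = ψ' := funext fun x => by
    refine (((((hasDerivAt_sinh_mul_ofReal k x).mul (hCd x)).sub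
      ((hasDerivAt_cosh_mul_ofReal k x).mul (hSd x))).const_mul k⁻¹).congr_deriv ?_).deriv
    simp only [ψ']
    field_simp
    ring
  have hψ' (x : ℝ) : deriv ψ' x = k ^ 2 * ψ x + g x := by
    refine ((((hasDerivAt_cosh_mul_ofReal k x).mul (hCd x)).sub
      ((hasDerivAt_sinh_mul_ofReal k x).mul (hSd x))).congr_deriv ?_).deriv
    simp only [ψ]
    field_simp
    linear_combination g x * Complex.cosh_sq_sub_sinh_sq (k * x)
  refine ⟨ψ, ?_, fun x hx => ?_, fun x => by rw [hψ, hψ']; ring, by simp [hψ, ψ', C]⟩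
  · exact contDiff_const.mul (((contDiff_sinh_mul_ofReal k).mul (contDiff_integral hcg a)).sub
      ((contDiff_cosh_mul_ofReal k).mul (contDiff_integral hsg a)))
  · have hzero (f : ℝ → ℂ) : ∫ t in a..x, g t * f t = 0 := by
      refine intervalIntegral.integral_zero_ae (.of_forall fun t ht => ?_)
      rw [hga t (by rw [uIoc_of_ge hx] at ht; exact ht.2), zero_mul]
    simp only [ψ, C, S, hzero, mul_zero, sub_zero]

theorem exists_neumann_potential (hk : k ≠ 0) (hg : ContDiff ℝ ∞ g) (hgc : HasCompactSupport g) :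
    ∃ Ψ : ℝ → ℂ, ContDiff ℝ ∞ Ψ ∧ HasCompactSupport Ψ ∧
      (∀ x < 0, deriv (deriv Ψ) x - k ^ 2 * Ψ x = g x) ∧
      deriv Ψ 0 = ∫ t in Iio (0 : ℝ), g t * Complex.cosh (k * t) := by
  obtain ⟨a, ha, hga⟩ := exists_neg_forall_le_eq_zero hgc
  obtain ⟨ψ, hψ, hψa, hψg, hψ0⟩ := exists_potential_eq_zero_of_le hk hg hga
  obtain ⟨χ, hχ, hχc, hχ1⟩ := exists_contDiff_hasCompactSupport_eqOn_one (1 - a)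
  have heq : EqOn (fun x => χ x • ψ x) ψ (Iio 1) := by
    intro x hx
    rcases le_or_gt x a with hxa | hxa
    · simp [hψa x hxa]
    · simp [hχ1 ⟨by linarith, by linarith [mem_Iio.mp hx]⟩]
  have heq' := heq.deriv isOpen_Iio
  refine ⟨fun x => χ x • ψ x, hχ.smul hψ, hχc.smul_right, fun x hx => ?_, ?_⟩
  · have hx1 : x ∈ Iio (1 : ℝ) := hx.trans one_pos
    rw [heq'.deriv isOpen_Iio hx1, heq hx1, hψg]
  · rw [heq' (mem_Iio.mpr one_pos), hψ0, intervalIntegral.integral_of_le ha.le,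
      ← integral_Iic_eq_integral_Iio]
    refine (setIntegral_eq_of_subset_of_forall_sdiff_eq_zero measurableSet_Iic
      Ioc_subset_Iic_self fun x hx => ?_).symm
    rw [hga x (not_lt.mp fun h => hx.2 ⟨h, hx.1⟩), zero_mul]

end Potential

lemma integral_mul_eq_zero_of_integral_mul_cosh_eq_zero (hk : k ≠ 0)
    (hc : ∀ Ψ, IsHalfLineTest Ψ → ∫ x in Iio 0, (deriv (deriv Ψ) x - k ^ 2 * Ψ x) * c x = 0)
    {g : ℝ → ℂ} (hg : ContDiff ℝ ∞ g) (hgc : HasCompactSupport g)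
    (hg0 : ∫ x in Iio (0 : ℝ), g x * Complex.cosh (k * x) = 0) : ∫ x in Iio 0, g x * c x = 0 := by
  obtain ⟨Ψ, hΨ, hΨc, hΨg, hΨ0⟩ := exists_neumann_potential hk hg hgc
  rw [← hc Ψ ⟨hΨ, hΨc, hΨ0.trans hg0⟩]
  exact setIntegral_congr_fun measurableSet_Iio fun x hx => by simp only [hΨg x hx]

lemma integrable_mul_of_hasCompactSupport {μ : Measure ℝ} (hc : LocallyIntegrable c μ)
    {g : ℝ → ℂ} (hg : Continuous g) (hgc : HasCompactSupport g) :
    Integrable (fun x => g x * c x) μ :=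
  hc.integrable_smul_left_of_hasCompactSupport hg hgc

lemma ae_eq_zero_of_integral_contDiff_mul_eq_zero {μ : Measure ℝ} (hc : LocallyIntegrable c μ)
    (h : ∀ g : ℝ → ℂ, ContDiff ℝ ∞ g → HasCompactSupport g → ∫ x, g x * c x ∂μ = 0) :
    ∀ᵐ x ∂μ, c x = 0 :=
  ae_eq_zero_of_integral_contDiff_smul_eq_zero hc fun f hf hfc =>
    h (fun x => f x) (Complex.ofRealCLM.contDiff.comp hf)
      (hfc.comp_left (g := Complex.ofReal) Complex.ofReal_zero)

lemma exists_ae_eq_const_mul_of_forall_integral_eq_zero {μ : Measure ℝ} {u : ℝ → ℂ}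
    (hu : LocallyIntegrable u μ) (hc : LocallyIntegrable c μ)
    (h : ∀ g : ℝ → ℂ, ContDiff ℝ ∞ g → HasCompactSupport g → ∫ x, g x * u x ∂μ = 0 →
      ∫ x, g x * c x ∂μ = 0) :
    ∃ A : ℂ, ∀ᵐ x ∂μ, c x = A * u x := by
  by_cases h₀ : ∃ g : ℝ → ℂ, ContDiff ℝ ∞ g ∧ HasCompactSupport g ∧ ∫ x, g x * u x ∂μ ≠ 0
  · obtain ⟨g₀, hg₀, hg₀c, hne⟩ := h₀
    set A := (∫ x, g₀ x * c x ∂μ) / ∫ x, g₀ x * u x ∂μ with hA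
    have hAu : LocallyIntegrable (fun x => A * u x) μ := hu.smul A
    refine ⟨A, (ae_eq_zero_of_integral_contDiff_mul_eq_zero (hc.sub hAu)
      fun g hg hgc => ?_).mono fun x hx => sub_eq_zero.mp hx⟩
    set J := (∫ x, g x * u x ∂μ) / ∫ x, g₀ x * u x ∂μ with hJ
    have hcomb {w : ℝ → ℂ} (hw : LocallyIntegrable w μ) :
        ∫ x, (g x - J * g₀ x) * w x ∂μ = (∫ x, g x * w x ∂μ) - J * ∫ x, g₀ x * w x ∂μ := by
      simp only [sub_mul, mul_assoc]
      rw [integral_sub (integrable_mul_of_hasCompactSupport hw hg.continuous hgc)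
        ((integrable_mul_of_hasCompactSupport hw hg₀.continuous hg₀c).const_mul J),
        integral_const_mul]
    have hzero := h (fun x => g x - J * g₀ x) (hg.sub (contDiff_const.mul hg₀))
      (hgc.sub hg₀c.mul_left) (by rw [hcomb hu, hJ, div_mul_cancel₀ _ hne, sub_self])
    rw [hcomb hc] at hzero
    simp only [Pi.sub_apply, mul_sub]
    rw [integral_sub (integrable_mul_of_hasCompactSupport hc hg.continuous hgc)
      (integrable_mul_of_hasCompactSupport hAu hg.continuous hgc)]
    simp only [mul_left_comm _ A, integral_const_mul]
    rw [← hzero, hJ, hA]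
    ring
  · push Not at h₀
    refine ⟨0, (ae_eq_zero_of_integral_contDiff_mul_eq_zero hc fun g hg hgc =>
      h g hg hgc (h₀ g hg hgc)).mono fun x hx => by rw [hx, zero_mul]⟩

theorem exists_ae_eq_const_mul_cosh (hk : k ≠ 0)
    (hcint : LocallyIntegrable c (volume.restrict (Iio 0)))
    (hc : ∀ Ψ, IsHalfLineTest Ψ → ∫ x in Iio 0, (deriv (deriv Ψ) x - k ^ 2 * Ψ x) * c x = 0) :
    ∃ A : ℂ, ∀ᵐ x ∂volume.restrict (Iio (0 : ℝ)), c x = A * Complex.cosh (k * x) :=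
  exists_ae_eq_const_mul_of_forall_integral_eq_zero
    (contDiff_cosh_mul_ofReal k).continuous.locallyIntegrable hcint
    fun _ => integral_mul_eq_zero_of_integral_mul_cosh_eq_zero hk hc

theorem IsHalfLineGreen.exists_ae_eq_modeGreen_add (hc : IsHalfLineGreen k p c) (hk : k ≠ 0)
    (hp : p ≤ 0) : ∃ A : ℂ, ∀ᵐ x ∂volume.restrict (Iio (0 : ℝ)),
      c x = modeGreen k p x + A * Complex.cosh (k * x) := by
  have hG := isHalfLineGreen_modeGreen hk hp
  obtain ⟨A, hA⟩ := exists_ae_eq_const_mul_cosh hk (hc.locallyIntegrable.sub hG.locallyIntegrable)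
    fun Ψ hΨ => by
      have hcont := continuous_helmholtz hΨ.smooth k
      have hcomp := hasCompactSupport_helmholtz hΨ.compact k
      simp only [Pi.sub_apply, mul_sub]
      rw [integral_sub (integrable_mul_of_hasCompactSupport hc.locallyIntegrable hcont hcomp)
        (integrable_mul_of_hasCompactSupport hG.locallyIntegrable hcont hcomp),
        hc.weak Ψ hΨ, hG.weak Ψ hΨ, sub_self]
  exact ⟨A, hA.mono fun x hx => eq_add_of_sub_eq' hx⟩

lemma tendsto_atBot_of_tendsto_ae {Y : Type*} [TopologicalSpace Y] [RegularSpace Y] {h : ℝ → Y}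
    (hcont : Continuous h) {y : Y} (hlim : Tendsto h (ae volume ⊓ atBot) (𝓝 y)) :
    Tendsto h atBot (𝓝 y) := by
  refine (closed_nhds_basis y).tendsto_right_iff.mpr fun V ⟨hVy, hV⟩ => ?_
  obtain ⟨S, hS, T, hT, hST⟩ := mem_inf_iff_superset.mp (hlim hVy)
  obtain ⟨N, hN⟩ := mem_atBot_sets.mp hT
  have hopen : IsOpen (Iio N ∩ h ⁻¹' Vᶜ) := isOpen_Iio.inter (hV.isOpen_compl.preimage hcont)
  have hempty : Iio N ∩ h ⁻¹' Vᶜ = ∅ := (hopen.measure_eq_zero_iff volume).mp <|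
    measure_mono_null (fun x hx hxS => hx.2 (hST ⟨hxS, hN x (le_of_lt hx.1)⟩)) hS
  filter_upwards [Iio_mem_atBot N] with x hx
  by_contra hxV
  exact hempty.subset ⟨hx, hxV⟩

lemma eq_zero_of_tendsto_exp_neg_add_exp (hk : k ≠ 0) (hk' : 0 ≤ k.re) {A B : ℂ}
    (h : Tendsto (fun x : ℝ => A * Complex.exp (-(k * x)) + B * Complex.exp (k * x)) atBot (𝓝 0)) :
    A = 0 := by
  have hsinh (t : ℝ) : A * Complex.sinh (k * t) = 0 := by
    have hdiff := ((h.comp (tendsto_atBot_add_const_right atBot t tendsto_id)).sub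
      (h.const_mul (Complex.exp (k * t)))).norm
    rw [mul_zero, sub_zero, norm_zero] at hdiff
    refine norm_le_zero_iff.mp (ge_of_tendsto hdiff ?_)
    filter_upwards [Iic_mem_atBot 0] with x hx
    have hcollect : A * Complex.exp (-(k * (x + t : ℝ))) + B * Complex.exp (k * (x + t : ℝ))
        - Complex.exp (k * t) * (A * Complex.exp (-(k * x)) + B * Complex.exp (k * x))
        = -2 * (A * Complex.sinh (k * t)) * Complex.exp (-(k * x)) := by
      push_cast
      rw [mul_add, neg_add, Complex.exp_add, Complex.exp_add, Complex.sinh]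
      ring
    have hnorm : 1 ≤ ‖Complex.exp (-(k * x))‖ := by
      rw [Complex.norm_exp, Complex.neg_re, Complex.re_mul_ofReal, Real.one_le_exp_iff]
      exact neg_nonneg.mpr (mul_nonpos_of_nonneg_of_nonpos hk' hx)
    simp only [Function.comp_apply, id_eq, hcollect, norm_mul _ (Complex.exp _), norm_mul (-2 : ℂ),
      norm_neg, RCLike.norm_ofNat]
    nlinarith [norm_nonneg (A * Complex.sinh (k * t))]
  have hderiv := ((hasDerivAt_sinh_mul_ofReal k 0).const_mul A).unique
    ((hasDerivAt_const (0 : ℝ) (0 : ℂ)).congr_of_eventuallyEq (.of_forall hsinh))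
  simpa [hk] using hderiv

lemma IsHalfLineGreen.exists_ae_eq_and_tendsto (hc : IsHalfLineGreen k p c) (hk : k ≠ 0)
    (hp : p ≤ 0) {s : ℂ}
    (hs : Tendsto (fun x : ℝ => c x - s * Complex.exp (k * x)) (ae volume ⊓ atBot) (𝓝 0)) :
    ∃ A : ℂ, (∀ᵐ x ∂volume.restrict (Iio (0 : ℝ)),
        c x = modeGreen k p x + A * Complex.cosh (k * x)) ∧
      Tendsto (fun x : ℝ => A / 2 * Complex.exp (-(k * x))
        + (Complex.cosh (k * p) / k - s + A / 2) * Complex.exp (k * x)) atBot (𝓝 0) := by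
  obtain ⟨A, hA⟩ := hc.exists_ae_eq_modeGreen_add hk hp
  refine ⟨A, hA, tendsto_atBot_of_tendsto_ae (by fun_prop) (hs.congr' ?_)⟩
  filter_upwards [((ae_restrict_iff' measurableSet_Iio).mp hA).filter_mono inf_le_left,
    (eventually_lt_atBot p).filter_mono inf_le_right] with x hx hxp
  rw [hx (hxp.trans_le hp), modeGreen_of_le hp hxp.le, Complex.cosh.eq_def (k * x)]
  ring

theorem IsHalfLineGreen.ae_eq_modeGreen (hc : IsHalfLineGreen k p c) (hk : k ≠ 0)
    (hk' : 0 ≤ k.re) (hp : p ≤ 0) {s : ℂ}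
    (hs : Tendsto (fun x : ℝ => c x - s * Complex.exp (k * x)) (ae volume ⊓ atBot) (𝓝 0)) :
    ∀ᵐ x ∂volume.restrict (Iio (0 : ℝ)), c x = modeGreen k p x := by
  obtain ⟨A, hA, hlim⟩ := hc.exists_ae_eq_and_tendsto hk hp hs
  have hA0 := eq_zero_of_tendsto_exp_neg_add_exp hk hk' hlim
  filter_upwards [hA] with x hx
  rw [hx, div_eq_zero_iff.mp hA0 |>.resolve_right two_ne_zero, zero_mul, add_zero]

theorem IsHalfLineGreen.amplitude_eq (hc : IsHalfLineGreen k p c) (hk : k ≠ 0)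
    (hk' : k.re = 0) (hp : p ≤ 0) {s : ℂ}
    (hs : Tendsto (fun x : ℝ => c x - s * Complex.exp (k * x)) (ae volume ⊓ atBot) (𝓝 0)) :
    s = Complex.cosh (k * p) / k := by
  obtain ⟨A, -, hlim⟩ := hc.exists_ae_eq_and_tendsto hk hp hs
  have hA0 := eq_zero_of_tendsto_exp_neg_add_exp hk hk'.ge hlim
  simp only [hA0, zero_mul, zero_add, add_zero] at hlim
  have hnorm := hlim.norm
  simp only [norm_mul, Complex.norm_exp, Complex.re_mul_ofReal, hk', zero_mul, Real.exp_zero,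
    mul_one, norm_zero, tendsto_const_nhds_iff, norm_eq_zero] at hnorm
  exact (sub_eq_zero.mp hnorm).symm

lemma deriv_clm_comp {E F : Type*} [NormedAddCommGroup E] [NormedSpace ℝ E]
    [NormedAddCommGroup F] [NormedSpace ℝ F] {Ψ : ℝ → E} (hΨ : ContDiff ℝ ∞ Ψ) (L : E →L[ℝ] F) :
    (deriv fun x => L (Ψ x)) = fun x => L (deriv Ψ x) :=
  funext fun x => (L.hasFDerivAt.comp_hasDerivAt x
    (hΨ.differentiable (by simp) x).hasDerivAt).deriv

lemma IsHalfLineTest.clm_comp {E F : Type*} [NormedAddCommGroup E] [NormedSpace ℝ E]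
    [NormedAddCommGroup F] [NormedSpace ℝ F] {Ψ : ℝ → E} (hΨ : IsHalfLineTest Ψ) (L : E →L[ℝ] F) :
    IsHalfLineTest fun x => L (Ψ x) where
  smooth := L.contDiff.comp hΨ.smooth
  compact := hΨ.compact.comp_left (map_zero L)
  deriv_zero := by simp [deriv_clm_comp hΨ.smooth L, hΨ.deriv_zero]

theorem isHalfLineGreen_of_forall_real {κ : ℝ} (hk : k ^ 2 = κ)
    (hc : LocallyIntegrable c (volume.restrict (Iio 0)))
    (h : ∀ ψ : ℝ → ℝ, IsHalfLineTest ψ →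
      ∫ x in Iio 0, ((deriv (deriv ψ) x - κ * ψ x : ℝ) : ℂ) * c x = -ψ p) :
    IsHalfLineGreen k p c where
  locallyIntegrable := hc
  weak Ψ hΨ := by
    set H : ℝ → ℂ := fun x => deriv (deriv Ψ) x - k ^ 2 * Ψ x with hH
    have hint (L : ℂ →L[ℝ] ℝ) : IntegrableOn (fun x => (L (H x) : ℂ) * c x) (Iio 0) :=
      integrable_mul_of_hasCompactSupport hc
        (Complex.continuous_ofReal.comp (L.continuous.comp (continuous_helmholtz hΨ.smooth k)))
        ((hasCompactSupport_helmholtz hΨ.compact k).comp_left (g := fun z => (L z : ℂ)) (by simp))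
    have hweak (L : ℂ →L[ℝ] ℝ) : ∫ x in Iio 0, (L (H x) : ℂ) * c x = -L (Ψ p) := by
      rw [← h _ (hΨ.clm_comp L), deriv_clm_comp hΨ.smooth L,
        deriv_clm_comp (contDiff_infty_iff_deriv.mp hΨ.smooth).2 L]
      refine integral_congr_ae (.of_forall fun x => ?_)
      simp only [hH, hk, map_sub, ← Complex.real_smul, map_smul, smul_eq_mul]
    have hsum := integral_add (hint Complex.reCLM) ((hint Complex.imCLM).const_mul Complex.I)
    rw [integral_const_mul, hweak, hweak] at hsum
    calc ∫ x in Iio 0, H x * c x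
        = -(Complex.reCLM (Ψ p) : ℂ) + Complex.I * -(Complex.imCLM (Ψ p) : ℂ) := by
          rw [← hsum]
          refine integral_congr_ae (.of_forall fun x => ?_)
          simp only [Complex.reCLM_apply, Complex.imCLM_apply]
          linear_combination -c x * Complex.re_add_im (H x)
      _ = -Ψ p := by
          simp only [Complex.reCLM_apply, Complex.imCLM_apply]
          linear_combination -Complex.re_add_im (Ψ p)

end HalfLine

section TestFunctions

open scoped ContDiff

lemma deriv_crossMode (n : ℕ) :
    deriv (crossMode n) = fun y => n * Real.pi * Real.sin (n * Real.pi * (1 - y)) := by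
  funext y
  refine ((((hasDerivAt_id y).const_sub 1).const_mul (n * Real.pi)).cos.congr_deriv ?_).deriv
  simp [mul_comm]

lemma deriv_deriv_crossMode (n : ℕ) :
    deriv (deriv (crossMode n)) = fun y => -((n * Real.pi) ^ 2 * crossMode n y) := by
  rw [deriv_crossMode]
  funext y
  refine (((((hasDerivAt_id y).const_sub 1).const_mul (n * Real.pi)).sin.const_mul
    (n * Real.pi)).congr_deriv ?_).deriv
  simp only [crossMode, id]
  ring

lemma exists_hasCompactSupport_eqOn_crossMode (n : ℕ) :
    ∃ θ : ℝ → ℝ, ContDiff ℝ ∞ θ ∧ HasCompactSupport θ ∧ EqOn θ (crossMode n) (Ioo (-2) 2) := by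
  obtain ⟨χ, hχ, hχc, hχ1⟩ := exists_contDiff_hasCompactSupport_eqOn_one 2
  exact ⟨fun y => χ y * crossMode n y, hχ.mul (contDiff_crossMode n), hχc.mul_right,
    fun y hy => by simp [hχ1 hy]⟩

lemma hasCompactSupport_mul_prod {R X Y : Type*} [MulZeroClass R] [TopologicalSpace X]
    [TopologicalSpace Y] [R1Space (X × Y)] {f : X → R} {g : Y → R} (hf : HasCompactSupport f)
    (hg : HasCompactSupport g) : HasCompactSupport fun z : X × Y => f z.1 * g z.2 := by
  refine HasCompactSupport.intro (hf.isCompact.prod hg.isCompact) fun z hz => ?_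
  rcases not_and_or.mp hz with h | h
  · rw [image_eq_zero_of_notMem_tsupport h, zero_mul]
  · rw [image_eq_zero_of_notMem_tsupport h, mul_zero]

lemma isNeumannTest_mul {ψ θ : ℝ → ℝ} (hψ : IsHalfLineTest ψ) (hθ : ContDiff ℝ ∞ θ)
    (hθc : HasCompactSupport θ) (hθ0 : deriv θ 0 = 0) (hθ1 : deriv θ 1 = 0) :
    IsNeumannTest fun z => ψ z.1 * θ z.2 where
  smooth := (hψ.smooth.comp contDiff_fst).mul (hθ.comp contDiff_snd)
  compact := hasCompactSupport_mul_prod hψ.compact hθc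
  bottom x _ := by simp [hθ0]
  top x _ := by simp [hθ1]
  side y _ := by simp [hψ.deriv_zero]

lemma laplacian_mul (ψ θ : ℝ → ℝ) (z : ℝ × ℝ) : laplacian (fun z => ψ z.1 * θ z.2) z
    = deriv (deriv ψ) z.1 * θ z.2 + ψ z.1 * deriv (deriv θ) z.2 := by
  simp [laplacian, iteratedDeriv_succ]

end TestFunctions

section StripModes

variable {ω p : ℝ} {γ : ℝ × ℝ → ℂ}

/-- The exponents of the cross modes of the strip: a solution of the Helmholtz equation separates
into products of `exp (± waveNumber ω n * x)` and `crossMode n y`. The mode `n = 0` is propagating,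
and the sign of its exponent is that of the outgoing mode; the others are evanescent. -/
noncomputable def waveNumber (ω : ℝ) (n : ℕ) : ℂ :=
  if n = 0 then -(Complex.I * ω) else (√((n * Real.pi) ^ 2 - ω ^ 2) : ℝ)

/-- The coefficient of `crossMode n` in the restriction of `γ` to the cross-section at `x`, up to
normalization: the modes `n ≠ 0` have square norm `1 / 2`. -/
noncomputable def modeCoeff (γ : ℝ × ℝ → ℂ) (n : ℕ) (x : ℝ) : ℂ :=
  ∫ y in Ioo (0 : ℝ) 1, crossMode n y • γ (x, y)

lemma waveNumber_zero (ω : ℝ) : waveNumber ω 0 = -(Complex.I * ω) := if_pos rfl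

lemma cosh_waveNumber_zero_mul (ω p : ℝ) :
    Complex.cosh (waveNumber ω 0 * p) = Real.cos (ω * p) := by
  rw [waveNumber_zero, neg_mul, Complex.cosh_neg, mul_assoc, mul_comm Complex.I,
    Complex.cosh_mul_I]
  push_cast
  rfl

lemma waveNumber_of_ne_zero (ω : ℝ) {n : ℕ} (hn : n ≠ 0) :
    waveNumber ω n = (√((n * Real.pi) ^ 2 - ω ^ 2) : ℝ) := if_neg hn

lemma sq_lt_sq_mul_pi (hωπ : |ω| < Real.pi) {n : ℕ} (hn : n ≠ 0) :
    ω ^ 2 < (n * Real.pi) ^ 2 := by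
  have hn' : (1 : ℝ) ≤ n := mod_cast Nat.one_le_iff_ne_zero.mpr hn
  rw [sq_lt_sq, abs_mul, Nat.abs_cast, abs_of_pos Real.pi_pos]
  exact hωπ.trans_le (le_mul_of_one_le_left Real.pi_pos.le hn')

lemma waveNumber_sq (hωπ : |ω| < Real.pi) (n : ℕ) :
    waveNumber ω n ^ 2 = (((n * Real.pi) ^ 2 - ω ^ 2 : ℝ) : ℂ) := by
  rcases eq_or_ne n 0 with rfl | hn
  · rw [waveNumber_zero, neg_sq, mul_pow, Complex.I_sq]
    push_cast
    ring
  · rw [waveNumber_of_ne_zero ω hn, ← Complex.ofReal_pow,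
      Real.sq_sqrt (sub_nonneg.mpr (sq_lt_sq_mul_pi hωπ hn).le)]

lemma waveNumber_ne_zero (hω : ω ≠ 0) (hωπ : |ω| < Real.pi) (n : ℕ) : waveNumber ω n ≠ 0 := by
  refine (pow_ne_zero_iff two_ne_zero).mp ?_
  rw [waveNumber_sq hωπ, Complex.ofReal_ne_zero]
  rcases eq_or_ne n 0 with rfl | hn
  · simpa using hω
  · exact (sub_pos.mpr (sq_lt_sq_mul_pi hωπ hn)).ne'

lemma waveNumber_re_nonneg (ω : ℝ) (n : ℕ) : 0 ≤ (waveNumber ω n).re := by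
  rcases eq_or_ne n 0 with rfl | hn
  · simp [waveNumber_zero]
  · rw [waveNumber_of_ne_zero ω hn, Complex.ofReal_re]
    exact Real.sqrt_nonneg _

lemma measurableSet_strip : MeasurableSet strip := measurableSet_Iio.prod measurableSet_Ioo

lemma strip_inter (R : ℝ) : strip ∩ {z | -R < z.1} = Ioo (-R) 0 ×ˢ Ioo 0 1 := by
  ext z
  simp only [strip, mem_inter_iff, mem_prod, mem_Iio, mem_Ioo, mem_ofPred_eq]
  tauto

lemma norm_modeCoeff_le {f : ℝ × ℝ → ℂ} {x M : ℝ} (hf : ∀ y ∈ Ioo (0 : ℝ) 1, ‖f (x, y)‖ ≤ M)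
    (n : ℕ) : ‖modeCoeff f n x‖ ≤ M := by
  refine (norm_setIntegral_le_of_norm_le_const (C := M) (by simp) fun y hy => ?_).trans (by simp)
  rw [norm_smul]
  exact (mul_le_of_le_one_left (norm_nonneg _) (abs_crossMode_le_one n y)).trans (hf y hy)

lemma modeCoeff_sub_mul_outgoingMode {f : ℝ × ℝ → ℂ} {x : ℝ}
    (hf : IntegrableOn (fun y => f (x, y)) (Ioo 0 1)) (s : ℂ) (n : ℕ) :
    modeCoeff (fun z => f z - s * outgoingMode ω z) n x
      = modeCoeff f n x - (if n = 0 then s else 0) * Complex.exp (waveNumber ω n * x) := by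
  have hmode := continuous_crossMode n
  have hconst : IntegrableOn (fun _ : ℝ => s * outgoingMode ω (x, 0)) (Ioo 0 1) :=
    integrableOn_const (by simp)
  simp only [modeCoeff, smul_sub]
  refine (integral_sub (integrableOn_Ioo_continuous_smul hf hmode)
    (integrableOn_Ioo_continuous_smul hconst hmode)).trans ?_
  rw [integral_smul_const, integral_crossMode]
  rcases eq_or_ne n 0 with rfl | hn
  · simp [waveNumber_zero, outgoingMode]
  · simp [hn]

namespace IsPointSourceSolution

lemma integrable_prod (hγ : IsPointSourceSolution ω p γ) (R : ℝ) :
    Integrable γ ((volume.restrict (Ioo (-R) 0)).prod (volume.restrict (Ioo (0 : ℝ) 1))) := by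
  rw [Measure.prod_restrict, ← Measure.volume_eq_prod, ← strip_inter]
  exact hγ.integrableOn R

lemma ae_integrableOn_slice (hγ : IsPointSourceSolution ω p γ) :
    ∀ᵐ x ∂volume.restrict (Iio (0 : ℝ)), IntegrableOn (fun y => γ (x, y)) (Ioo 0 1) := by
  have hN (N : ℕ) : ∀ᵐ x : ℝ, x ∈ Ioo (-(N : ℝ)) 0 → IntegrableOn (fun y => γ (x, y)) (Ioo 0 1) :=
    (ae_restrict_iff' measurableSet_Ioo).mp (hγ.integrable_prod N).prod_right_ae
  refine (ae_restrict_iff' measurableSet_Iio).mpr ?_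
  filter_upwards [ae_all_iff.mpr hN] with x hx hx0
  obtain ⟨N, hN⟩ := exists_nat_gt (-x)
  exact hx N ⟨neg_lt.mp hN, hx0⟩

lemma locallyIntegrable (hγ : IsPointSourceSolution ω p γ) :
    LocallyIntegrable γ (volume.restrict strip) := by
  intro z
  have hopen : IsOpen {w : ℝ × ℝ | -(1 - z.1) < w.1} := isOpen_lt continuous_const continuous_fst
  refine ⟨_, hopen.mem_nhds (by simp), ?_⟩
  rw [IntegrableOn, Measure.restrict_restrict hopen.measurableSet, inter_comm]
  exact hγ.integrableOn _

lemma locallyIntegrable_modeCoeff (hγ : IsPointSourceSolution ω p γ) (n : ℕ) :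
    LocallyIntegrable (modeCoeff γ n) (volume.restrict (Iio 0)) := by
  intro x
  refine ⟨_, Ioi_mem_nhds (show -(1 - x) < x by linarith), ?_⟩
  rw [IntegrableOn, Measure.restrict_restrict measurableSet_Ioi, Ioi_inter_Iio]
  exact ((hγ.integrable_prod _).bdd_smul 1
    ((continuous_crossMode n).comp continuous_snd).aestronglyMeasurable
    (.of_forall fun z => abs_crossMode_le_one n z.2)).integral_prod_left

lemma integral_mul_modeCoeff (hγ : IsPointSourceSolution ω p γ) (n : ℕ) {h : ℝ → ℝ}
    (hh : Continuous h) (hhc : HasCompactSupport h) :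
    ∫ x in Iio (0 : ℝ), h x * modeCoeff γ n x
      = ∫ z in strip, γ z * (h z.1 * crossMode n z.2 : ℝ) := by
  obtain ⟨θ, hθ, hθc, hθn⟩ := exists_hasCompactSupport_eqOn_crossMode n
  have hint : IntegrableOn (fun z => γ z * (h z.1 * crossMode n z.2 : ℝ)) strip := by
    refine IntegrableOn.congr_fun (hγ.locallyIntegrable.integrable_smul_left_of_hasCompactSupport
      ((hh.comp continuous_fst).mul (hθ.continuous.comp continuous_snd))
      (hasCompactSupport_mul_prod hhc hθc)) (fun z hz => ?_) measurableSet_strip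
    have hz2 : z.2 ∈ Ioo (-2 : ℝ) 2 := ⟨by linarith [hz.2.1], by linarith [hz.2.2]⟩
    simp only [Pi.mul_apply, Function.comp_apply, hθn hz2, Complex.real_smul]
    ring
  rw [strip, Measure.volume_eq_prod, setIntegral_prod _ hint]
  refine integral_congr_ae (.of_forall fun x => ?_)
  simp only [modeCoeff]
  rw [← integral_const_mul]
  refine integral_congr_ae (.of_forall fun y => ?_)
  simp only [Complex.real_smul]
  push_cast
  ring

lemma isHalfLineGreen_modeCoeff (hγ : IsPointSourceSolution ω p γ) (hωπ : |ω| < Real.pi) (n : ℕ) :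
    IsHalfLineGreen (waveNumber ω n) p (modeCoeff γ n) := by
  refine isHalfLineGreen_of_forall_real (waveNumber_sq hωπ n)
    (hγ.locallyIntegrable_modeCoeff n) fun ψ hψ => ?_
  obtain ⟨θ, hθ, hθc, hθn⟩ := exists_hasCompactSupport_eqOn_crossMode n
  have hθ' := hθn.deriv isOpen_Ioo
  have hθ'' := hθ'.deriv isOpen_Ioo
  have hθ0 : deriv θ 0 = 0 := by
    simp [hθ' (show (0 : ℝ) ∈ Ioo (-2) 2 by norm_num), deriv_crossMode, Real.sin_nat_mul_pi]
  have hθ1 : deriv θ 1 = 0 := by simp [hθ' (show (1 : ℝ) ∈ Ioo (-2) 2 by norm_num), deriv_crossMode]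
  have hweak := hγ.weak _ (isNeumannTest_mul hψ hθ hθc hθ0 hθ1)
  have hψ2 := (contDiff_infty_iff_deriv.mp (contDiff_infty_iff_deriv.mp hψ.smooth).2).2
  rw [hθn (show (1 : ℝ) ∈ Ioo (-2) 2 by norm_num), crossMode_one, mul_one] at hweak
  rw [← hweak]
  refine (hγ.integral_mul_modeCoeff n (hψ2.continuous.sub (hψ.smooth.continuous.const_mul _))
    (hψ.compact.deriv.deriv.sub hψ.compact.mul_left)).trans ?_
  refine setIntegral_congr_fun measurableSet_strip fun z hz => ?_
  have hz2 : z.2 ∈ Ioo (-2 : ℝ) 2 := ⟨by linarith [hz.2.1], by linarith [hz.2.2]⟩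
  simp only [Pi.sub_apply, laplacian_mul, hθn hz2, hθ'' hz2, deriv_deriv_crossMode]
  push_cast
  ring

lemma tendsto_modeCoeff_sub (hγ : IsPointSourceSolution ω p γ) {s : ℂ} (hs : HasAmplitude ω γ s)
    (n : ℕ) : Tendsto (fun x : ℝ => modeCoeff γ n x
      - (if n = 0 then s else 0) * Complex.exp (waveNumber ω n * x))
      (ae volume ⊓ atBot) (𝓝 0) := by
  obtain ⟨α, hα, C, x₀, hC⟩ := hs
  have hlim : Tendsto (fun x : ℝ => C * Real.exp (α * x)) (ae volume ⊓ atBot) (𝓝 0) := by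
    simpa using ((Real.tendsto_exp_atBot.comp
      (tendsto_id.const_mul_atBot hα)).const_mul C).mono_left inf_le_right
  refine squeeze_zero_norm' ?_ hlim
  filter_upwards [((ae_restrict_iff' measurableSet_Iio).mp hγ.ae_integrableOn_slice).filter_mono
      inf_le_left, (eventually_lt_atBot 0).filter_mono inf_le_right,
    (eventually_le_atBot x₀).filter_mono inf_le_right] with x hint hx0 hx
  rw [← modeCoeff_sub_mul_outgoingMode (hint hx0)]
  exact norm_modeCoeff_le (fun y hy => hC (x, y) ⟨hx0, hy⟩ hx) n

theorem modeCoeff_ae_eq (hγ : IsPointSourceSolution ω p γ) (hω : ω ≠ 0) (hωπ : |ω| < Real.pi)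
    (hp : p ≤ 0) {s : ℂ} (hs : HasAmplitude ω γ s) (n : ℕ) :
    ∀ᵐ x ∂volume.restrict (Iio (0 : ℝ)), modeCoeff γ n x = modeGreen (waveNumber ω n) p x :=
  (hγ.isHalfLineGreen_modeCoeff hωπ n).ae_eq_modeGreen (waveNumber_ne_zero hω hωπ n)
    (waveNumber_re_nonneg ω n) hp (hγ.tendsto_modeCoeff_sub hs n)

theorem eq_of_hasAmplitude (hγ : IsPointSourceSolution ω p γ) (hω : ω ≠ 0) (hωπ : |ω| < Real.pi)
    (hp : p ≤ 0) {s : ℂ} (hs : HasAmplitude ω γ s) : s = Complex.I * Real.cos (ω * p) / ω := by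
  have hlim := hγ.tendsto_modeCoeff_sub hs 0
  simp only [if_true] at hlim
  rw [(hγ.isHalfLineGreen_modeCoeff hωπ 0).amplitude_eq (waveNumber_ne_zero hω hωπ 0)
    (by simp [waveNumber_zero]) hp hlim, cosh_waveNumber_zero_mul, waveNumber_zero]
  have hω' : (ω : ℂ) ≠ 0 := mod_cast hω
  field_simp
  linear_combination -(Real.cos (ω * p) : ℂ) * Complex.I_sq

end IsPointSourceSolution

end StripModes

section ExpGap

variable {a b t t' : ℝ}

/-- The difference of the decaying exponentials with rates `a` and `b`, normalized so that their
derivatives at `0` agree. -/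
noncomputable def expGap (a b t : ℝ) : ℝ := Real.exp (-(a * t)) / a - Real.exp (-(b * t)) / b

lemma mul_exp_neg_le_one (x : ℝ) : x * Real.exp (-x) ≤ 1 := by
  rw [Real.exp_neg, ← div_eq_mul_inv, div_le_one (Real.exp_pos x)]
  linarith [Real.add_one_le_exp x]

lemma abs_exp_neg_mul_sub_le (ha : 0 < a) (hab : a ≤ b) (ht : 0 ≤ t) :
    |Real.exp (-(a * t)) - Real.exp (-(b * t))| ≤ (b - a) / a := by
  have hle : Real.exp (-(b * t)) ≤ Real.exp (-(a * t)) :=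
    Real.exp_le_exp.mpr (neg_le_neg (mul_le_mul_of_nonneg_right hab ht))
  rw [abs_of_nonneg (sub_nonneg.mpr hle), le_div_iff₀ ha]
  have hfactor : Real.exp (-(b * t)) = Real.exp (-(a * t)) * Real.exp (-((b - a) * t)) := by
    rw [← Real.exp_add]
    ring_nf
  calc (Real.exp (-(a * t)) - Real.exp (-(b * t))) * a
      = Real.exp (-(a * t)) * a * (1 - Real.exp (-((b - a) * t))) := by rw [hfactor]; ring
    _ ≤ Real.exp (-(a * t)) * a * ((b - a) * t) := by
        refine mul_le_mul_of_nonneg_left ?_ (by positivity)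
        linarith [Real.add_one_le_exp (-((b - a) * t))]
    _ = (b - a) * (a * t * Real.exp (-(a * t))) := by ring
    _ ≤ b - a := mul_le_of_le_one_right (sub_nonneg.mpr hab) (mul_exp_neg_le_one _)

lemma abs_expGap_mul_le (ha : 0 < a) (hab : a ≤ b) (ht : 0 ≤ t) :
    |expGap a b t| * b ≤ 2 * ((b - a) / a) := by
  have hb : 0 < b := ha.trans_le hab
  have hsplit : expGap a b t * b
      = (b - a) / a * Real.exp (-(a * t)) + (Real.exp (-(a * t)) - Real.exp (-(b * t))) := by
    rw [expGap]
    field_simp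
    ring
  have hfirst : |(b - a) / a * Real.exp (-(a * t))| ≤ (b - a) / a := by
    have hdefect : 0 ≤ (b - a) / a := div_nonneg (sub_nonneg.mpr hab) ha.le
    rw [abs_of_nonneg (by positivity)]
    exact mul_le_of_le_one_right hdefect (Real.exp_le_one_iff.mpr (neg_nonpos.mpr (by positivity)))
  calc |expGap a b t| * b = |expGap a b t * b| := by rw [abs_mul, abs_of_pos hb]
    _ ≤ (b - a) / a + (b - a) / a := by
        rw [hsplit]
        exact (abs_add_le _ _).trans (add_le_add hfirst (abs_exp_neg_mul_sub_le ha hab ht))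
    _ = 2 * ((b - a) / a) := (two_mul _).symm

lemma hasDerivAt_exp_neg_mul_div (ha : a ≠ 0) (t : ℝ) :
    HasDerivAt (fun t => Real.exp (-(a * t)) / a) (-Real.exp (-(a * t))) t := by
  refine ((((hasDerivAt_id t).const_mul a).neg).exp.div_const a).congr_deriv ?_
  simp only [id, Pi.neg_apply]
  field_simp

lemma abs_expGap_sub_le (ha : 0 < a) (hab : a ≤ b) (ht : 0 ≤ t) (ht' : 0 ≤ t') :
    |expGap a b t - expGap a b t'| ≤ (b - a) / a * |t - t'| := by
  have hderiv (t : ℝ) : HasDerivAt (expGap a b)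
      (-(Real.exp (-(a * t)) - Real.exp (-(b * t)))) t :=
    ((hasDerivAt_exp_neg_mul_div ha.ne' t).sub
      (hasDerivAt_exp_neg_mul_div (ha.trans_le hab).ne' t)).congr_deriv (by ring)
  refine (convex_Ici (0 : ℝ)).norm_image_sub_le_of_norm_hasDerivWithin_le
    (fun x _ => (hderiv x).hasDerivWithinAt) (fun x hx => ?_) ht' ht
  rw [norm_neg]
  exact abs_exp_neg_mul_sub_le ha hab hx

end ExpGap

section StripGreen

open Asymptotics

variable {ω p q : ℝ}

/-- The frequency of `crossMode (n + 1)`. -/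
noncomputable def crossFreq (n : ℕ) : ℝ := (n + 1 : ℕ) * Real.pi

/-- The decay rate of the evanescent modes of the strip: the real number `waveNumber ω (n + 1)`. -/
noncomputable def decayRate (ω : ℝ) (n : ℕ) : ℝ := √(crossFreq n ^ 2 - ω ^ 2)

/-- The relative difference of `crossFreq` and `decayRate`. -/
noncomputable def rateDefect (ω : ℝ) (n : ℕ) : ℝ := (crossFreq n - decayRate ω n) / decayRate ω n

lemma waveNumber_succ (ω : ℝ) (n : ℕ) : waveNumber ω (n + 1) = decayRate ω n :=
  waveNumber_of_ne_zero ω n.succ_ne_zero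

lemma pi_le_crossFreq (n : ℕ) : Real.pi ≤ crossFreq n :=
  le_mul_of_one_le_left Real.pi_pos.le (mod_cast Nat.le_add_left 1 n)

lemma crossFreq_pos (n : ℕ) : 0 < crossFreq n := Real.pi_pos.trans_le (pi_le_crossFreq n)

lemma decayRate_pos (hωπ : |ω| < Real.pi) (n : ℕ) : 0 < decayRate ω n :=
  Real.sqrt_pos.mpr (sub_pos.mpr (sq_lt_sq_mul_pi hωπ n.succ_ne_zero))

lemma decayRate_sq (hωπ : |ω| < Real.pi) (n : ℕ) : decayRate ω n ^ 2 = crossFreq n ^ 2 - ω ^ 2 :=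
  Real.sq_sqrt (sub_nonneg.mpr (sq_lt_sq_mul_pi hωπ n.succ_ne_zero).le)

lemma decayRate_le_crossFreq (ω : ℝ) (n : ℕ) : decayRate ω n ≤ crossFreq n :=
  Real.sqrt_le_iff.mpr ⟨(crossFreq_pos n).le, sub_le_self _ (sq_nonneg ω)⟩

lemma rateDefect_nonneg (ω : ℝ) (n : ℕ) : 0 ≤ rateDefect ω n :=
  div_nonneg (sub_nonneg.mpr (decayRate_le_crossFreq ω n)) (Real.sqrt_nonneg _)

lemma rateDefect_le (hωπ : |ω| < Real.pi) (n : ℕ) :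
    rateDefect ω n ≤ ω ^ 2 / decayRate ω n ^ 2 := by
  have hpos := decayRate_pos hωπ n
  have hsq := decayRate_sq hωπ n
  rw [rateDefect, div_le_div_iff₀ hpos (pow_pos hpos 2), sq (decayRate ω n), ← mul_assoc]
  refine mul_le_mul_of_nonneg_right ?_ hpos.le
  nlinarith [decayRate_le_crossFreq ω n, crossFreq_pos n]

lemma sq_mul_le_decayRate_sq (hωπ : |ω| < Real.pi) (n : ℕ) :
    (Real.pi ^ 2 - ω ^ 2) * (n + 1 : ℕ) ^ 2 ≤ decayRate ω n ^ 2 := by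
  have hn : (1 : ℝ) ≤ (n + 1 : ℕ) ^ 2 := one_le_pow₀ (mod_cast Nat.le_add_left 1 n)
  rw [decayRate_sq hωπ, crossFreq, mul_pow]
  nlinarith [sq_nonneg ω]

lemma summable_rateDefect (hωπ : |ω| < Real.pi) : Summable (rateDefect ω) := by
  have hgap : 0 < Real.pi ^ 2 - ω ^ 2 := by
    rw [sub_pos, sq_lt_sq, abs_of_pos Real.pi_pos]
    exact hωπ
  have hsum : Summable fun n : ℕ => ω ^ 2 / (Real.pi ^ 2 - ω ^ 2) * (1 / ((n + 1 : ℕ) : ℝ) ^ 2) :=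
    ((summable_nat_add_iff 1).mpr (Real.summable_one_div_nat_pow.mpr one_lt_two)).mul_left _
  refine hsum.of_nonneg_of_le (rateDefect_nonneg ω) fun n => (rateDefect_le hωπ n).trans ?_
  rw [div_mul_div_comm, mul_one]
  exact div_le_div_of_nonneg_left (sq_nonneg ω) (by positivity) (sq_mul_le_decayRate_sq hωπ n)

/-- The part of `stripGreen` that is Lipschitz up to the pole: the evanescent modes, minus their
counterparts at frequency `0`. -/
noncomputable def regularPart (ω t y : ℝ) : ℝ :=
  ∑' n, crossMode (n + 1) y * expGap (decayRate ω n) (crossFreq n) t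

lemma summable_regularPart (hωπ : |ω| < Real.pi) {t : ℝ} (ht : 0 ≤ t) (y : ℝ) :
    Summable fun n => crossMode (n + 1) y * expGap (decayRate ω n) (crossFreq n) t := by
  refine .of_norm_bounded ((summable_rateDefect hωπ).mul_left 2) fun n => ?_
  rw [norm_mul]
  calc ‖crossMode (n + 1) y‖ * |expGap (decayRate ω n) (crossFreq n) t|
      ≤ |expGap (decayRate ω n) (crossFreq n) t| :=
        mul_le_of_le_one_left (abs_nonneg _) (abs_crossMode_le_one _ y)
    _ ≤ |expGap (decayRate ω n) (crossFreq n) t| * crossFreq n :=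
        le_mul_of_one_le_right (abs_nonneg _) (by linarith [pi_le_crossFreq n, Real.pi_gt_three])
    _ ≤ 2 * rateDefect ω n :=
        abs_expGap_mul_le (decayRate_pos hωπ n) (decayRate_le_crossFreq ω n) ht

lemma abs_crossMode_sub_le (n : ℕ) (y y' : ℝ) :
    |crossMode n y - crossMode n y'| ≤ n * Real.pi * |y - y'| := by
  refine (Real.abs_cos_sub_cos_le _ _).trans_eq ?_
  rw [← mul_sub, sub_sub_sub_cancel_left, abs_mul, abs_sub_comm y' y,
    abs_of_nonneg (by positivity)]

lemma abs_regularPart_sub_le (hωπ : |ω| < Real.pi) {t t' : ℝ} (ht : 0 ≤ t) (ht' : 0 ≤ t')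
    (y y' : ℝ) : |regularPart ω t y - regularPart ω t' y'|
      ≤ (2 * ∑' n, rateDefect ω n) * (|t - t'| + |y - y'|) := by
  rw [regularPart, regularPart, ← (summable_regularPart hωπ ht y).tsum_sub
    (summable_regularPart hωπ ht' y'), ← tsum_mul_left, ← tsum_mul_right, ← Real.norm_eq_abs]
  refine tsum_of_norm_bounded (((summable_rateDefect hωπ).mul_left 2).mul_right _).hasSum
    fun n => ?_
  set g := expGap (decayRate ω n) (crossFreq n)
  have hpos := decayRate_pos hωπ n
  have hle := decayRate_le_crossFreq ω n
  have hmode := abs_crossMode_sub_le (n + 1) y y'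
  have hdefect := rateDefect_nonneg ω n
  calc |crossMode (n + 1) y * g t - crossMode (n + 1) y' * g t'|
      = |crossMode (n + 1) y * (g t - g t')
          + (crossMode (n + 1) y - crossMode (n + 1) y') * g t'| := by ring_nf
    _ ≤ |g t - g t'| + crossFreq n * |y - y'| * |g t'| := by
        refine (abs_add_le _ _).trans ?_
        rw [abs_mul, abs_mul]
        exact add_le_add (mul_le_of_le_one_left (abs_nonneg _) (abs_crossMode_le_one _ y))
          (mul_le_mul_of_nonneg_right hmode (abs_nonneg _))
    _ = |g t - g t'| + |g t'| * crossFreq n * |y - y'| := by ring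
    _ ≤ rateDefect ω n * |t - t'| + 2 * rateDefect ω n * |y - y'| :=
        add_le_add (abs_expGap_sub_le hpos hle ht ht')
          (mul_le_mul_of_nonneg_right (abs_expGap_mul_le hpos hle ht') (abs_nonneg _))
    _ ≤ 2 * rateDefect ω n * (|t - t'| + |y - y'|) := by
        rw [mul_add]
        gcongr
        linarith

lemma exists_lipschitzWith_regularPart (hωπ : |ω| < Real.pi) (q : ℝ) :
    ∃ K, LipschitzWith K fun z : ℝ × ℝ => regularPart ω |z.1 - q| z.2 := by
  refine ⟨_, LipschitzWith.of_dist_le' (K := (2 * ∑' n, rateDefect ω n) * 2) fun z w => ?_⟩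
  have hdefect : 0 ≤ ∑' n, rateDefect ω n := tsum_nonneg (rateDefect_nonneg ω)
  have hfst : |(|z.1 - q| - |w.1 - q|)| ≤ dist z w := by
    refine (abs_abs_sub_abs_le_abs_sub _ _).trans ?_
    rw [sub_sub_sub_cancel_right]
    exact le_max_left _ _
  rw [Real.dist_eq, mul_assoc, two_mul (dist z w)]
  exact (abs_regularPart_sub_le hωπ (abs_nonneg _) (abs_nonneg _) _ _).trans
    (mul_le_mul_of_nonneg_left (add_le_add hfst (le_max_right _ _)) (by positivity))

lemma continuous_regularPart (hωπ : |ω| < Real.pi) (q : ℝ) :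
    Continuous fun z : ℝ × ℝ => regularPart ω |z.1 - q| z.2 :=
  (exists_lipschitzWith_regularPart hωπ q).choose_spec.continuous

lemma isBigO_regularPart (hωπ : |ω| < Real.pi) (q : ℝ) (w : ℝ × ℝ) :
    (fun z : ℝ × ℝ => regularPart ω |z.1 - q| z.2 - regularPart ω |w.1 - q| w.2)
      =O[𝓝 w] fun z => z - w := by
  obtain ⟨K, hK⟩ := exists_lipschitzWith_regularPart hωπ q
  exact IsBigO.of_bound K (.of_forall fun z => by
    simpa only [dist_eq_norm] using hK.dist_le_mul z w)

/-- `logPart` is the logarithm of the norm of this function, which vanishes at the pole. -/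
noncomputable def logArg (t y : ℝ) : ℂ :=
  1 - Complex.exp (Real.pi * (-t + Complex.I * (1 - y)))

/-- The singular part of `stripGreen`: the evanescent modes at frequency `0`, in closed form. -/
noncomputable def logPart (t y : ℝ) : ℝ := -(1 / Real.pi * Real.log ‖logArg t y‖)

lemma logArg_ne_zero {t y : ℝ} (h : t ≠ 0 ∨ y ∈ Ioo (-1) 1) : logArg t y ≠ 0 := by
  intro hzero
  obtain ⟨n, hn⟩ := Complex.exp_eq_one_iff.mp (sub_eq_zero.mp hzero).symm
  have hre : t = 0 := by simpa using congrArg Complex.re hn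
  have him : 1 - y = 2 * n := by
    have him := congrArg Complex.im hn
    simp only [Complex.mul_im, Complex.add_im, Complex.add_re, Complex.neg_im, Complex.neg_re,
      Complex.sub_re, Complex.sub_im, Complex.one_re, Complex.one_im, Complex.mul_re,
      Complex.I_re, Complex.I_im, Complex.ofReal_re, Complex.ofReal_im, Complex.intCast_re,
      Complex.intCast_im, Complex.re_ofNat, Complex.im_ofNat] at him
    refine mul_left_cancel₀ Real.pi_ne_zero ?_
    linear_combination him
  rcases h with ht | hy
  · exact ht hre
  · have hlow : (0 : ℝ) < (n : ℤ) := by linarith [hy.2]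
    have hupp : ((n : ℤ) : ℝ) < 1 := by linarith [hy.1]
    norm_cast at hlow hupp
    lia

lemma norm_exp_pi_mul_lt_one {t : ℝ} (ht : 0 < t) (y : ℝ) :
    ‖Complex.exp (Real.pi * (-t + Complex.I * (1 - y)))‖ < 1 := by
  rw [Complex.norm_exp, Real.exp_lt_one_iff]
  simpa using mul_pos Real.pi_pos ht

lemma hasSum_logPart {t : ℝ} (ht : 0 < t) (y : ℝ) :
    HasSum (fun n => crossMode (n + 1) y * (Real.exp (-(crossFreq n * t)) / crossFreq n))
      (logPart t y) := by
  have hsum := (Complex.hasSum_re (Complex.hasSum_taylorSeries_neg_log'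
    (norm_exp_pi_mul_lt_one ht y))).mul_left (1 / Real.pi)
  have hlog : 1 / Real.pi * (-Complex.log (logArg t y)).re = logPart t y := by
    rw [Complex.neg_re, Complex.log_re, logPart]
    ring
  rw [← logArg, hlog] at hsum
  refine hsum.congr_fun fun n => ?_
  have hexponent : ((n + 1 : ℕ) : ℂ) * (Real.pi * (-t + Complex.I * (1 - y)))
      = (-(crossFreq n * t) : ℝ) + ((n + 1 : ℕ) * Real.pi * (1 - y) : ℝ) * Complex.I := by
    rw [crossFreq]
    push_cast
    ring
  have hcast : (n : ℂ) + 1 = ((n + 1 : ℕ) : ℝ) := by push_cast; rfl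
  rw [← Complex.exp_nat_mul, hexponent, hcast, Complex.div_ofReal_re, Complex.exp_add,
    ← Complex.ofReal_exp, Complex.re_ofReal_mul, Complex.exp_ofReal_mul_I_re, crossMode, crossFreq]
  field_simp

/-- The outgoing Green function of the infinite strip `ℝ × (0, 1)` with pole on the upper side, as a
function of the distance `t` to the cross-section of the pole and of the height `y`. -/
noncomputable def stripGreen (ω t y : ℝ) : ℂ :=
  lineGreen (waveNumber ω 0) t + (logPart t y + regularPart ω t y : ℝ)

lemma lineGreen_waveNumber_zero_im (ω t : ℝ) :
    (lineGreen (waveNumber ω 0) t).im = Real.cos (ω * t) / (2 * ω) := by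
  have hrw : lineGreen (waveNumber ω 0) t
      = Complex.I * Complex.exp ((ω * t : ℝ) * Complex.I) / (2 * ω : ℝ) := by
    rw [lineGreen, waveNumber_zero, div_eq_mul_inv, mul_inv, inv_neg, mul_inv, Complex.inv_I]
    push_cast
    ring_nf
  rw [hrw, Complex.div_ofReal_im, Complex.I_mul_im, Complex.exp_ofReal_mul_I_re]

lemma stripGreen_im (ω t y : ℝ) : (stripGreen ω t y).im = Real.cos (ω * t) / (2 * ω) := by
  rw [stripGreen, Complex.add_im, Complex.ofReal_im, add_zero, lineGreen_waveNumber_zero_im]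

lemma hasSum_stripGreen (hωπ : |ω| < Real.pi) {t : ℝ} (ht : 0 < t) (y : ℝ) :
    HasSum (fun n => ((if n = 0 then 1 else 2) * crossMode n y) • lineGreen (waveNumber ω n) t)
      (stripGreen ω t y) := by
  rw [← hasSum_nat_add_iff' 1, Finset.sum_range_one, stripGreen, if_pos rfl, crossMode_zero,
    one_mul, one_smul, add_sub_cancel_left]
  refine (Complex.hasSum_ofReal.mpr
    ((hasSum_logPart ht y).add (summable_regularPart hωπ ht.le y).hasSum)).congr_fun fun n => ?_
  have hpos : (decayRate ω n : ℂ) ≠ 0 := mod_cast (decayRate_pos hωπ n).ne'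
  rw [if_neg n.succ_ne_zero, waveNumber_succ, lineGreen, ← mul_add, expGap, add_sub_cancel,
    Complex.real_smul]
  push_cast
  rw [neg_mul]
  field_simp

lemma summable_norm_lineGreen (hωπ : |ω| < Real.pi) {t : ℝ} (ht : 0 < t) :
    Summable fun n => ‖lineGreen (waveNumber ω n) t‖ := by
  refine (hasSum_stripGreen hωπ ht 1).summable.norm.of_nonneg_of_le (fun _ => norm_nonneg _)
    fun n => ?_
  rw [crossMode_one, mul_one, norm_smul]
  refine le_mul_of_one_le_left (norm_nonneg _) ?_
  split_ifs <;> norm_num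

lemma continuous_stripGreen (hωπ : |ω| < Real.pi) {t : ℝ} (ht : 0 < t) :
    Continuous (stripGreen ω t) :=
  continuous_of_hasSum_crossMode_smul (summable_norm_lineGreen hωπ ht) (hasSum_stripGreen hωπ ht)

lemma integral_crossMode_smul_stripGreen (hωπ : |ω| < Real.pi) {t : ℝ} (ht : 0 < t) (n : ℕ) :
    ∫ y in Ioo (0 : ℝ) 1, crossMode n y • stripGreen ω t y = lineGreen (waveNumber ω n) t :=
  integral_crossMode_smul_of_hasSum (summable_norm_lineGreen hωπ ht) (hasSum_stripGreen hωπ ht) n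

lemma differentiable_lineGreen (k : ℂ) : Differentiable ℝ (lineGreen k) := fun t =>
  ((hasDerivAt_exp_mul_ofReal (-k) t).div_const (2 * k)).differentiableAt

lemma isBigO_lineGreen (k : ℂ) (q : ℝ) (w : ℝ × ℝ) :
    (fun z : ℝ × ℝ => lineGreen k |z.1 - q| - lineGreen k |w.1 - q|) =O[𝓝 w] fun z => z - w := by
  have habs : Continuous fun z : ℝ × ℝ => |z.1 - q| := by fun_prop
  refine ((differentiable_lineGreen k _).isBigO_sub.comp_tendsto (habs.tendsto w)).trans
    (IsBigO.of_bound 1 (.of_forall fun z => ?_))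
  rw [one_mul]
  refine (abs_abs_sub_abs_le_abs_sub _ _).trans ?_
  rw [sub_sub_sub_cancel_right]
  exact norm_fst_le (z - w)

lemma continuousAt_stripGreen {w : ℝ × ℝ} (hωπ : |ω| < Real.pi)
    (hw : w.1 ≠ q ∨ w.2 ∈ Ioo (-1) 1) :
    ContinuousAt (fun z : ℝ × ℝ => stripGreen ω |z.1 - q| z.2) w := by
  have hline : Continuous fun z : ℝ × ℝ => lineGreen (waveNumber ω 0) |z.1 - q| :=
    (differentiable_lineGreen _).continuous.comp (by fun_prop)
  have harg : ContinuousAt (fun z : ℝ × ℝ => logArg |z.1 - q| z.2) w := by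
    unfold logArg
    fun_prop
  have hne : logArg |w.1 - q| w.2 ≠ 0 :=
    logArg_ne_zero (hw.imp_left fun h => abs_ne_zero.mpr (sub_ne_zero.mpr h))
  have hlog : ContinuousAt (fun z : ℝ × ℝ => logPart |z.1 - q| z.2) w :=
    ((harg.norm.log (norm_ne_zero_iff.mpr hne)).const_mul (1 / Real.pi)).neg
  exact hline.continuousAt.add (Complex.continuous_ofReal.continuousAt.comp
    (hlog.add (continuous_regularPart hωπ q).continuousAt))

lemma differentiableAt_logPart {w : ℝ × ℝ} (hw : w.1 ≠ q) :
    DifferentiableAt ℝ (fun z : ℝ × ℝ => logPart |z.1 - q| z.2) w := by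
  have hne : |w.1 - q| ≠ 0 := abs_ne_zero.mpr (sub_ne_zero.mpr hw)
  have habs : DifferentiableAt ℝ (fun z : ℝ × ℝ => ((|z.1 - q| : ℝ) : ℂ)) w :=
    Complex.ofRealCLM.differentiableAt.comp w
      ((differentiableAt_fst.sub_const q).abs (sub_ne_zero.mpr hw))
  have hheight : DifferentiableAt ℝ (fun z : ℝ × ℝ => 1 - (z.2 : ℂ)) w :=
    (Complex.ofRealCLM.differentiableAt.comp w differentiableAt_snd).const_sub 1
  have harg : DifferentiableAt ℝ (fun z : ℝ × ℝ => logArg |z.1 - q| z.2) w :=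
    ((habs.neg.add (hheight.const_mul Complex.I)).const_mul (Real.pi : ℂ)).cexp.const_sub 1
  have hargne : logArg |w.1 - q| w.2 ≠ 0 := logArg_ne_zero (.inl hne)
  exact (((harg.norm ℝ hargne).log (norm_ne_zero_iff.mpr hargne)).const_mul (1 / Real.pi)).neg

lemma isBigO_stripGreen {w : ℝ × ℝ} (hωπ : |ω| < Real.pi) (hw : w.1 ≠ q) :
    (fun z : ℝ × ℝ => stripGreen ω |z.1 - q| z.2 - stripGreen ω |w.1 - q| w.2)
      =O[𝓝 w] fun z => z - w := by
  have hreal := ((differentiableAt_logPart hw).isBigO_sub.add (isBigO_regularPart hωπ q w))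
  refine ((isBigO_lineGreen (waveNumber ω 0) q w).add
    (Complex.isBigO_ofReal_left.mpr hreal)).congr_left fun z => ?_
  simp only [stripGreen]
  push_cast
  ring

lemma abs_log_norm_one_sub_exp_sub_log_norm_le {w : ℂ} (hw0 : w ≠ 0) (hw : ‖w‖ ≤ 1 / 2) :
    |Real.log ‖1 - Complex.exp w‖ - Real.log ‖w‖| ≤ 3 / 2 * ‖w‖ := by
  set v := (Complex.exp w - 1 - w) / w with hv
  have hwn : 0 < ‖w‖ := norm_pos_iff.mpr hw0
  have hvn : ‖v‖ ≤ ‖w‖ := by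
    rw [hv, norm_div, div_le_iff₀ hwn, ← sq]
    exact Complex.norm_exp_sub_one_sub_id_le (hw.trans (by norm_num))
  have hfactor : 1 - Complex.exp w = -(w * (1 + v)) := by
    rw [hv]
    field_simp
    ring
  have hv1 : 1 + v ≠ 0 := by
    intro h
    have : ‖v‖ = 1 := by rw [eq_neg_of_add_eq_zero_right h, norm_neg, norm_one]
    linarith
  rw [hfactor, norm_neg, norm_mul, Real.log_mul hwn.ne' (norm_ne_zero_iff.mpr hv1),
    add_sub_cancel_left, ← Complex.log_re]
  calc |(Complex.log (1 + v)).re| ≤ ‖Complex.log (1 + v)‖ := Complex.abs_re_le_norm _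
    _ ≤ 3 / 2 * ‖v‖ := Complex.norm_log_one_add_half_le_self (hvn.trans hw)
    _ ≤ 3 / 2 * ‖w‖ := by gcongr

lemma norm_pi_mul_eq_pi_mul_dist₁ (p : ℝ) (z : ℝ × ℝ) :
    ‖(Real.pi : ℂ) * (-(|z.1 - p| : ℝ) + Complex.I * (1 - z.2))‖ = Real.pi * dist₁ p z := by
  rw [norm_mul, Complex.norm_of_nonneg Real.pi_pos.le, ← Complex.ofReal_neg, ← Complex.ofReal_one,
    ← Complex.ofReal_sub, mul_comm Complex.I, Complex.norm_add_mul_I, dist₁, neg_sq, sq_abs,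
    ← neg_sub z.2 1, neg_sq]

lemma norm_sub_le_dist₁ (p : ℝ) (z : ℝ × ℝ) : ‖z - (p, 1)‖ ≤ dist₁ p z :=
  max_le (Real.abs_le_sqrt (le_add_of_nonneg_right (sq_nonneg _)))
    (Real.abs_le_sqrt (le_add_of_nonneg_left (sq_nonneg _)))

lemma isBigO_sub_dist₁ (p : ℝ) (l : Filter (ℝ × ℝ)) : (fun z => z - (p, 1)) =O[l] dist₁ p :=
  IsBigO.of_bound 1 (.of_forall fun z => by
    rw [one_mul]
    exact (norm_sub_le_dist₁ p z).trans (le_abs_self _))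

lemma continuous_dist₁ (p : ℝ) : Continuous (dist₁ p) := by
  unfold dist₁
  fun_prop

lemma dist₁_pos {z : ℝ × ℝ} (hz : z.2 ≠ 1) : 0 < dist₁ p z :=
  Real.sqrt_pos.mpr (add_pos_of_nonneg_of_pos (sq_nonneg _) (sq_pos_iff.mpr (sub_ne_zero.mpr hz)))

lemma abs_logPart_sub_le {z : ℝ × ℝ} (hz : 0 < dist₁ p z) (hz' : Real.pi * dist₁ p z ≤ 1 / 2) :
    |logPart |z.1 - p| z.2
      - (1 / Real.pi * Real.log (1 / dist₁ p z) - Real.log Real.pi / Real.pi)|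
      ≤ 3 / 2 * dist₁ p z := by
  have hnorm := norm_pi_mul_eq_pi_mul_dist₁ p z
  have hne : (Real.pi : ℂ) * (-(|z.1 - p| : ℝ) + Complex.I * (1 - z.2)) ≠ 0 := by
    rw [← norm_ne_zero_iff, hnorm]
    exact (mul_pos Real.pi_pos hz).ne'
  have hlog := abs_log_norm_one_sub_exp_sub_log_norm_le hne (hnorm.trans_le hz')
  rw [hnorm, Real.log_mul Real.pi_ne_zero hz.ne', ← logArg] at hlog
  calc |logPart |z.1 - p| z.2
        - (1 / Real.pi * Real.log (1 / dist₁ p z) - Real.log Real.pi / Real.pi)|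
      = 1 / Real.pi * |Real.log ‖logArg |z.1 - p| z.2‖
          - (Real.log Real.pi + Real.log (dist₁ p z))| := by
        rw [← abs_of_pos (one_div_pos.mpr Real.pi_pos), ← abs_mul,
          abs_of_pos (one_div_pos.mpr Real.pi_pos), ← abs_neg, logPart, one_div (dist₁ p z),
          Real.log_inv]
        ring_nf
    _ ≤ 1 / Real.pi * (3 / 2 * (Real.pi * dist₁ p z)) :=
        mul_le_mul_of_nonneg_left hlog (by positivity)
    _ = 3 / 2 * dist₁ p z := by field_simp

lemma isBigO_logPart_sub (p : ℝ) :
    (fun z : ℝ × ℝ => logPart |z.1 - p| z.2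
      - (1 / Real.pi * Real.log (1 / dist₁ p z) - Real.log Real.pi / Real.pi))
      =O[𝓝[strip] (p, 1)] dist₁ p := by
  have hlim : Tendsto (fun z => Real.pi * dist₁ p z) (𝓝[strip] (p, 1)) (𝓝 0) := by
    have hlim := ((continuous_dist₁ p).const_mul Real.pi).tendsto (p, 1)
    rw [show Real.pi * dist₁ p (p, 1) = 0 by simp [dist₁]] at hlim
    exact hlim.mono_left nhdsWithin_le_nhds
  refine IsBigO.of_bound (3 / 2) ?_
  filter_upwards [hlim.eventually_le_const (u := 1 / 2) (by norm_num), self_mem_nhdsWithin]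
    with z hz hzs
  have hpos : 0 < dist₁ p z := dist₁_pos hzs.2.2.ne
  rw [Real.norm_of_nonneg hpos.le]
  exact abs_logPart_sub_le hpos hz

/-- The outgoing Green function of the half-strip with pole `(p, 1)`, built by reflecting the pole
in the line `x = 0`. -/
noncomputable def green (ω p : ℝ) (z : ℝ × ℝ) : ℂ :=
  stripGreen ω |z.1 - p| z.2 + stripGreen ω |z.1 + p| z.2

/-- The constant term of `green ω p` at its pole. -/
noncomputable def greenConstant (ω p : ℝ) : ℂ :=
  lineGreen (waveNumber ω 0) 0 + (regularPart ω 0 1 - Real.log Real.pi / Real.pi : ℝ)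
    + stripGreen ω |p + p| 1

lemma hasLogConstant_green (hωπ : |ω| < Real.pi) (hp : p ≠ 0) :
    HasLogConstant p (green ω p) (greenConstant ω p) := by
  have hreflected := isBigO_stripGreen (q := -p) (w := (p, 1)) hωπ (self_ne_neg.mpr hp)
  have hsmooth := ((isBigO_lineGreen (waveNumber ω 0) p (p, 1)).add
    (Complex.isBigO_ofReal_left.mpr (isBigO_regularPart hωπ p (p, 1)))).add hreflected
  refine (((hsmooth.mono nhdsWithin_le_nhds).trans (isBigO_sub_dist₁ p _)).add
    (Complex.isBigO_ofReal_left.mpr (isBigO_logPart_sub p))).congr_left fun z => ?_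
  simp only [green, greenConstant, stripGreen, sub_neg_eq_add, sub_self, abs_zero]
  push_cast
  ring

lemma cos_mul_abs (a x : ℝ) : Real.cos (a * |x|) = Real.cos (a * x) := by
  rcases abs_choice x with h | h <;> simp [h]

lemma greenConstant_im (ω p : ℝ) : (greenConstant ω p).im = Real.cos (ω * p) ^ 2 / ω := by
  simp only [greenConstant, Complex.add_im, Complex.ofReal_im, stripGreen_im,
    lineGreen_waveNumber_zero_im, cos_mul_abs, ← two_mul p, mul_left_comm ω 2, Real.cos_two_mul,
    mul_zero, Real.cos_zero]
  ring

lemma green_im (ω p : ℝ) (z : ℝ × ℝ) :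
    (green ω p z).im = Real.cos (ω * p) * Real.cos (ω * z.1) / ω := by
  rw [green, Complex.add_im, stripGreen_im, stripGreen_im, cos_mul_abs, cos_mul_abs, mul_sub,
    mul_add, Real.cos_sub, Real.cos_add]
  ring

lemma continuousAt_green {z : ℝ × ℝ} (hωπ : |ω| < Real.pi)
    (hz : (z.1 ≠ p ∧ z.1 ≠ -p) ∨ z.2 ∈ Ioo (-1) 1) : ContinuousAt (green ω p) z := by
  have hreflected := continuousAt_stripGreen (q := -p) hωπ (hz.imp_left And.right)
  simp only [sub_neg_eq_add] at hreflected
  exact (continuousAt_stripGreen hωπ (hz.imp_left And.left)).add hreflected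

lemma continuousOn_green (hωπ : |ω| < Real.pi) (p : ℝ) : ContinuousOn (green ω p) strip :=
  fun _ hz => (continuousAt_green hωπ
    (.inr ⟨by linarith [hz.2.1], hz.2.2⟩)).continuousWithinAt

lemma continuous_green_slice {x : ℝ} (hωπ : |ω| < Real.pi) (hxp : x ≠ p) (hxp' : x ≠ -p) :
    Continuous fun y => green ω p (x, y) :=
  (continuous_stripGreen hωπ (abs_pos.mpr (sub_ne_zero.mpr hxp))).add
    (continuous_stripGreen hωπ (abs_pos.mpr (mt eq_neg_iff_add_eq_zero.mpr hxp')))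

lemma modeCoeff_green {x : ℝ} (hωπ : |ω| < Real.pi) (hxp : x ≠ p) (hxp' : x ≠ -p) (n : ℕ) :
    modeCoeff (green ω p) n x = modeGreen (waveNumber ω n) p x := by
  have hpole : 0 < |x - p| := abs_pos.mpr (sub_ne_zero.mpr hxp)
  have hreflected : 0 < |x + p| := abs_pos.mpr (mt eq_neg_iff_add_eq_zero.mpr hxp')
  have hint {t : ℝ} (ht : 0 < t) :
      IntegrableOn (fun y => crossMode n y • stripGreen ω t y) (Ioo 0 1) :=
    ((continuous_crossMode n).smul (continuous_stripGreen hωπ ht)).integrableOn_Icc.mono_set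
      Ioo_subset_Icc_self
  simp only [modeCoeff, green, smul_add]
  rw [integral_add (hint hpole) (hint hreflected), integral_crossMode_smul_stripGreen hωπ hpole,
    integral_crossMode_smul_stripGreen hωπ hreflected, modeGreen]

end StripGreen

section Conclusion

variable {ω p q : ℝ} {γ : ℝ × ℝ → ℂ}

lemma IsPointSourceSolution.ae_eqOn_slice (hγ : IsPointSourceSolution ω p γ) (hω : ω ≠ 0)
    (hωπ : |ω| < Real.pi) (hp : p ≤ 0) {s : ℂ} (hs : HasAmplitude ω γ s) :
    ∀ᵐ x ∂volume.restrict (Iio (0 : ℝ)),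
      EqOn (fun y => γ (x, y)) (fun y => green ω p (x, y)) (Ioo 0 1) := by
  filter_upwards [hγ.ae_integrableOn_slice, ae_all_iff.mpr (hγ.modeCoeff_ae_eq hω hωπ hp hs),
    ae_restrict_of_ae (Measure.ae_ne volume p), ae_restrict_mem measurableSet_Iio]
    with x hint hcoeff hxp hx
  have hxp' : x ≠ -p := (hx.trans_le (neg_nonneg.mpr hp)).ne
  have hgreen : IntegrableOn (fun y => green ω p (x, y)) (Ioo 0 1) :=
    (continuous_green_slice hωπ hxp hxp').integrableOn_Icc.mono_set Ioo_subset_Icc_self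
  have hdiff : ∀ᵐ y ∂volume.restrict (Ioo (0 : ℝ) 1), γ (x, y) - green ω p (x, y) = 0 := by
    refine ae_eq_zero_of_integral_crossMode_smul_eq_zero (hint.sub hgreen) fun n => ?_
    have hmode := continuous_crossMode n
    simp only [smul_sub]
    rw [integral_sub (integrableOn_Ioo_continuous_smul hint hmode)
      (integrableOn_Ioo_continuous_smul hgreen hmode), sub_eq_zero]
    exact (hcoeff n).trans (modeCoeff_green hωπ hxp hxp' n).symm
  have hmaps : MapsTo (fun y : ℝ => (x, y)) (Ioo 0 1) strip := fun y hy => ⟨hx, hy⟩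
  have hcont : Continuous fun y : ℝ => (x, y) := by fun_prop
  exact Measure.eqOn_open_of_ae_eq (hdiff.mono fun y => sub_eq_zero.mp) isOpen_Ioo
    (hγ.continuousOn.comp hcont.continuousOn hmaps)
    (continuous_green_slice hωπ hxp hxp').continuousOn

theorem IsPointSourceSolution.eqOn_green (hγ : IsPointSourceSolution ω p γ) (hω : ω ≠ 0)
    (hωπ : |ω| < Real.pi) (hp : p ≤ 0) {s : ℂ} (hs : HasAmplitude ω γ s) :
    EqOn γ (green ω p) strip := by
  rintro ⟨x, y⟩ ⟨hx, hy⟩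
  have hmaps : MapsTo (fun x : ℝ => (x, y)) (Iio 0) strip := fun x hx => ⟨hx, hy⟩
  have hcont : Continuous fun x : ℝ => (x, y) := by fun_prop
  exact Measure.eqOn_open_of_ae_eq ((hγ.ae_eqOn_slice hω hωπ hp hs).mono fun x hx => hx hy)
    isOpen_Iio (hγ.continuousOn.comp hcont.continuousOn hmaps)
    ((continuousOn_green hωπ p).comp hcont.continuousOn hmaps) hx

namespace IsOutgoingSolution

theorem hasAmplitude_iff (hγ : IsOutgoingSolution ω p γ) (hω : ω ≠ 0) (hωπ : |ω| < Real.pi)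
    (hp : p ≤ 0) (s : ℂ) : HasAmplitude ω γ s ↔ s = Complex.I * Real.cos (ω * p) / ω := by
  refine ⟨hγ.eq_of_hasAmplitude hω hωπ hp, ?_⟩
  rintro rfl
  obtain ⟨s, hs⟩ := hγ.outgoing
  rwa [← hγ.eq_of_hasAmplitude hω hωπ hp hs]

theorem eqOn_green (hγ : IsOutgoingSolution ω p γ) (hω : ω ≠ 0) (hωπ : |ω| < Real.pi)
    (hp : p ≤ 0) : EqOn γ (green ω p) strip :=
  let ⟨_, hs⟩ := hγ.outgoing
  hγ.toIsPointSourceSolution.eqOn_green hω hωπ hp hs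

end IsOutgoingSolution

lemma hasBoundaryValue_of_eqOn_green (hγ : EqOn γ (green ω p) strip) (hωπ : |ω| < Real.pi)
    (hqp : q ≠ p) (hqp' : q ≠ -p) : HasBoundaryValue q γ (green ω p (q, 1)) :=
  (continuousAt_green (z := (q, 1)) hωπ (.inl ⟨hqp, hqp'⟩)).continuousWithinAt.tendsto.congr'
    hγ.symm.eventuallyEq_nhdsWithin

lemma hasLogConstant_of_eqOn_green (hγ : EqOn γ (green ω p) strip) (hωπ : |ω| < Real.pi)
    (hp : p ≠ 0) : HasLogConstant p γ (greenConstant ω p) := by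
  refine (hasLogConstant_green hωπ hp).congr' ?_ .rfl
  filter_upwards [self_mem_nhdsWithin] with z hz
  rw [hγ hz]

lemma green_comm (ω p q : ℝ) : green ω p (q, 1) = green ω q (p, 1) := by
  simp only [green]
  rw [abs_sub_comm, add_comm q p]

lemma outgoingMode_eq (ω : ℝ) (z : ℝ × ℝ) :
    outgoingMode ω z = Complex.exp ((-(ω * z.1) : ℝ) * Complex.I) := by
  rw [outgoingMode]
  push_cast
  ring_nf

lemma im_sub_mul_outgoingMode_of_eqOn_green (hγ : EqOn γ (green ω p) strip) {z : ℝ × ℝ}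
    (hz : z ∈ strip) :
    (γ z - Complex.I * Real.cos (ω * p) / ω * outgoingMode ω z).im = 0 := by
  have hmode : Complex.I * Real.cos (ω * p) / ω * outgoingMode ω z
      = (Real.cos (ω * p) / ω : ℝ) * (Complex.I * outgoingMode ω z) := by
    push_cast
    ring
  rw [hγ hz, Complex.sub_im, green_im, hmode, Complex.im_ofReal_mul, Complex.I_mul_im,
    outgoingMode_eq, Complex.exp_ofReal_mul_I_re, Real.cos_neg]
  ring

end Conclusion

end HalfStrip

open HalfStrip in
/-- Negative `ω` describes incoming radiation; `p = 0` puts the source in the corner of the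
half-strip, where the logarithm has coefficient `2 / π` instead of `1 / π`. -/
theorem mainTheorem2_general (ω p₁ p₂ : ℝ) (hω : ω ≠ 0) (hωπ : |ω| < Real.pi)
    (hp₁ : p₁ ≤ 0) (hp₂ : p₂ ≤ 0) (hne : p₁ ≠ p₂) (γ₁ γ₂ : ℝ × ℝ → ℂ)
    (hγ₁ : IsOutgoingSolution ω p₁ γ₁) (hγ₂ : IsOutgoingSolution ω p₂ γ₂) :
    (∃ Γt : ℂ, HasBoundaryValue p₂ γ₁ Γt ∧ HasBoundaryValue p₁ γ₂ Γt ∧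
      ((ω : ℂ) * Γt).im = Real.cos (ω * p₁) * Real.cos (ω * p₂)) ∧
    (p₁ ≠ 0 → ∃ Γ₁ : ℂ, HasLogConstant p₁ γ₁ Γ₁ ∧
      ((ω : ℂ) * Γ₁).im = Real.cos (ω * p₁) ^ 2) ∧
    (p₂ ≠ 0 → ∃ Γ₂ : ℂ, HasLogConstant p₂ γ₂ Γ₂ ∧
      ((ω : ℂ) * Γ₂).im = Real.cos (ω * p₂) ^ 2) ∧
    (∀ s : ℂ, HasAmplitude ω γ₁ s ↔ s = Complex.I * Real.cos (ω * p₁) / ω) ∧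
    (∀ s : ℂ, HasAmplitude ω γ₂ s ↔ s = Complex.I * Real.cos (ω * p₂) / ω) ∧
    (∀ z ∈ strip,
      (γ₁ z - Complex.I * Real.cos (ω * p₁) / ω * outgoingMode ω z).im = 0) ∧
    (∀ z ∈ strip,
      (γ₂ z - Complex.I * Real.cos (ω * p₂) / ω * outgoingMode ω z).im = 0) := by
  have heq₁ := hγ₁.eqOn_green hω hωπ hp₁
  have heq₂ := hγ₂.eqOn_green hω hωπ hp₂
  have hsum : p₁ + p₂ ≠ 0 := fun h => hne (by linarith)
  have hconst (p : ℝ) : ((ω : ℂ) * greenConstant ω p).im = Real.cos (ω * p) ^ 2 := by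
    rw [Complex.im_ofReal_mul, greenConstant_im, mul_div_cancel₀ _ hω]
  refine ⟨⟨green ω p₁ (p₂, 1), ?_, ?_, ?_⟩,
    fun hp => ⟨_, hasLogConstant_of_eqOn_green heq₁ hωπ hp, hconst p₁⟩,
    fun hp => ⟨_, hasLogConstant_of_eqOn_green heq₂ hωπ hp, hconst p₂⟩,
    hγ₁.hasAmplitude_iff hω hωπ hp₁, hγ₂.hasAmplitude_iff hω hωπ hp₂,
    fun _ => im_sub_mul_outgoingMode_of_eqOn_green heq₁,
    fun _ => im_sub_mul_outgoingMode_of_eqOn_green heq₂⟩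
  · exact hasBoundaryValue_of_eqOn_green heq₁ hωπ hne.symm
      (mt eq_neg_iff_add_eq_zero.mp (add_comm p₁ p₂ ▸ hsum))
  · rw [green_comm]
    exact hasBoundaryValue_of_eqOn_green heq₂ hωπ hne (mt eq_neg_iff_add_eq_zero.mp hsum)
  · rw [Complex.im_ofReal_mul, green_im, mul_div_cancel₀ _ hω]

theorem mainTheorem2 (ω p₁ p₂ : ℝ) (hω : 0 < ω) (hωπ : ω < Real.pi)
    (hp₁ : p₁ < 0) (hp₂ : p₂ < 0) (hne : p₁ ≠ p₂) (γ₁ γ₂ : ℝ × ℝ → ℂ)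
    (hγ₁ : HalfStrip.IsOutgoingSolution ω p₁ γ₁)
    (hγ₂ : HalfStrip.IsOutgoingSolution ω p₂ γ₂) :
    (∃ Γt : ℂ, HalfStrip.HasBoundaryValue p₂ γ₁ Γt ∧ HalfStrip.HasBoundaryValue p₁ γ₂ Γt ∧
      ((ω : ℂ) * Γt).im = Real.cos (ω * p₁) * Real.cos (ω * p₂)) ∧
    (∃ Γ₁ : ℂ, HalfStrip.HasLogConstant p₁ γ₁ Γ₁ ∧
      ((ω : ℂ) * Γ₁).im = Real.cos (ω * p₁) ^ 2) ∧
    (∃ Γ₂ : ℂ, HalfStrip.HasLogConstant p₂ γ₂ Γ₂ ∧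
      ((ω : ℂ) * Γ₂).im = Real.cos (ω * p₂) ^ 2) ∧
    (∀ s : ℂ, HalfStrip.HasAmplitude ω γ₁ s ↔ s = Complex.I * Real.cos (ω * p₁) / ω) ∧
    (∀ s : ℂ, HalfStrip.HasAmplitude ω γ₂ s ↔ s = Complex.I * Real.cos (ω * p₂) / ω) ∧
    (∀ z ∈ HalfStrip.strip,
      (γ₁ z - Complex.I * Real.cos (ω * p₁) / ω * HalfStrip.outgoingMode ω z).im = 0) ∧
    (∀ z ∈ HalfStrip.strip,
      (γ₂ z - Complex.I * Real.cos (ω * p₂) / ω * HalfStrip.outgoingMode ω z).im = 0) := by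
  obtain ⟨hvalue, hconst₁, hconst₂, hrest⟩ := mainTheorem2_general ω p₁ p₂ hω.ne'
    ((abs_of_pos hω).trans_lt hωπ) hp₁.le hp₂.le hne γ₁ γ₂ hγ₁ hγ₂
  exact ⟨hvalue, hconst₁ hp₁.ne, hconst₂ hp₂.ne, hrest⟩
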